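/- Let $\mathbb F$ be a field of characteristic $0$. Let $\mathcal A$ be a Lie conformal algebra over $\mathbb F$ that is free as an $\mathbb F[\partial]$-module and contains a Virasoro element $L$, i.e. $[L_\lambda L]=(\partial+2\lambda)L$, $L_{(0)}:=[L_\lambda\,\cdot\,]|_{\lambda=0}=\partial$, and $L_{(1)}:=\frac{d}{d\lambda}[L_\lambda\,\cdot\,]|_{\lambda=0}$ is diagonalizable on $\mathcal A$. Let $M$ be an $\mathcal A$-module that is free as an $\mathbb F[\partial]$-module and conformal with respect to $L$, i.e. $(L_\lambda\,\cdot\,)|_{\lambda=0}=\partial^M$ and $\frac{d}{d\lambda}(L_\lambda\,\cdot\,)|_{\lambda=0}$ is diagonalizable on $M$. (Ranks may be infinite.) For $q\ge 0$ let $\widetilde C^q=\widetilde C^q(\mathcal A,M)$ be the space of $\mathbb F$-linear maps $f:\mathcal A^{\otimes q}\to M[\lambda_1,\dots,\lambda_q]$ that are conformally antilinear, $f_{\lambda_1,\dots,\lambda_q}(\dots,\partial a_i,\dots)=-\lambda_i f_{\lambda_1,\dots,\lambda_q}(\dots,a_i,\dots)$, and skew-symmetric under simultaneous permutations of the $a_i$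 and $\lambda_i$, with the differential $$(\mathbf d f)_{\lambda_1,\dots,\lambda_{q+1}}(a_1,\dots,a_{q+1})=\sum_{k}(-1)^{k+1}a_{k\,\lambda_k}f_{\dots,\hat\lambda_k,\dots}(\dots,\hat a_k,\dots)+\sum_{k<l}(-1)^{k+l}f_{\lambda_k+\lambda_l,\dots,\hat\lambda_k,\dots,\hat\lambda_l,\dots}([a_{k\,\lambda_k}a_l],\dots,\hat a_k,\dots,\hat a_l,\dots)$$ and $(\partial f)_{\lambda_1,\dots,\lambda_q}(a_1,\dots,a_q)=(\partial^M+\lambda_1+\dots+\lambda_q)f_{\lambda_1,\dots,\lambda_q}(a_1,\dots,a_q)$. Let $\widetilde{\mathrm H}^q(\mathcal A,M)$ be the (basic) cohomology of $(\widetilde C^\bullet,\mathbf d)$ and $\mathrm H^q(\mathcal A,M)$ the (reduced) cohomology of the quotient complex $C^\bullet=\widetilde C^\bullet/\partial\widetilde C^\bullet$. Define $\tau:\widetilde C^{q+1}\to\widetilde C^{q}$ by $$(\tau f)_{\lambda_1,\dots,\lambda_q}(a_1,\dots,a_q)=(-1)^{q}\tfrac{d}{d\lambda}f_{\lambda_1,\dots,\lambda_q,\lambda}(a_1,\dots,a_q,L)\big|_{\lambda=0}.$$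 Then for every $q\ge1$, $$\dim \mathrm H^q(\mathcal A,M)=\dim\widetilde{\mathrm H}^q(\mathcal A,M)+\dim\widetilde{\mathrm H}^{q+1}(\mathcal A,M)$$ (as cardinal numbers, if the dimensions are infinite). Moreover, if $(f_i)_{i\in I}$ are cocycles in $\widetilde C^q$ whose classes form a basis of $\widetilde{\mathrm H}^q(\mathcal A,M)$ and $(g_j)_{j\in J}$ are cocycles in $\widetilde C^{q+1}$ whose classes form a basis of $\widetilde{\mathrm H}^{q+1}(\mathcal A,M)$, then the images in $C^q$ of the $f_i$ and of the $\tau(\partial g_j)$ are cocycles, and their classes, indexed by the disjoint union $I\sqcup J$, form a basis of $\mathrm H^q(\mathcal A,M)$. -/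

import Mathlib

open scoped TensorProduct Polynomial

set_option linter.unusedSectionVars false

noncomputable section

namespace LieConformal

universe u v w

/-! The base field is `F`, an `F[∂]`-module is a module over Mathlib's `F[X]`, with `∂` the action
of `X`. The space `V[λ] = F[λ] ⊗ V` is `F[X] ⊗[F] V`, and `V[λ₁, …, λ_q]` is
`MvPolynomial (Fin q) F ⊗[F] V`. -/

/-- The operator `∂` on an `F[∂]`-module, as an `F`-linear map. -/
def del (F : Type u) (V : Type v) [Field F] [AddCommGroup V] [Module F V] [Module F[X] V]
    [IsScalarTower F F[X] V] : V →ₗ[F] V :=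
  Algebra.lsmul F F V (Polynomial.X : F[X])

section LambdaMaps

variable {F : Type u} [Field F]
variable {U : Type*} [AddCommGroup U] [Module F U]
variable {V : Type*} [AddCommGroup V] [Module F V]
variable {W : Type*} [AddCommGroup W] [Module F W]
variable {P : Type*} [CommRing P] [Algebra F P]

/-- Evaluate an element of `W[λ]` at `λ = p`, where `p` lies in a commutative `F`-algebra `P`. -/
def substLam (W : Type*) [AddCommGroup W] [Module F W] (p : P) : F[X] ⊗[F] W →ₗ[F] P ⊗[F] W :=
  LinearMap.rTensor W (Polynomial.aeval p : F[X] →ₐ[F] P).toLinearMap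

/-- Evaluate an element of `W[λ₁, …, λ_q]` at `λ_i = p i`, where the `p i` lie in a commutative
`F`-algebra `P`. -/
def substVars (W : Type*) [AddCommGroup W] [Module F W] {q : ℕ} (p : Fin q → P) :
    MvPolynomial (Fin q) F ⊗[F] W →ₗ[F] P ⊗[F] W :=
  LinearMap.rTensor W (MvPolynomial.aeval p : MvPolynomial (Fin q) F →ₐ[F] P).toLinearMap

/-- For a `λ`-product `B : u ⊗ v ↦ u_λ v ∈ W[λ]` and `p` in a commutative `F`-algebra `P`, the
product `u_p v ∈ P ⊗ W` with the parameter `λ` set to `p`, extended `P`-bilinearly to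
`u ∈ P ⊗ U` and `v ∈ P ⊗ V`. -/
def lamProd (B : U →ₗ[F] V →ₗ[F] F[X] ⊗[F] W) (p : P) :
    P ⊗[F] U →ₗ[P] P ⊗[F] V →ₗ[P] P ⊗[F] W :=
  LinearMap.liftBaseChange P
    ((LinearMap.liftBaseChangeEquiv (R := F) (M := V) (N := P ⊗[F] W) P).toLinearMap.restrictScalars F
      ∘ₗ B.compr₂ (substLam W p))

theorem lamProd_tmul (B : U →ₗ[F] V →ₗ[F] F[X] ⊗[F] W) (p s t : P) (x : U) (y : V) :
    lamProd B p (s ⊗ₜ x) (t ⊗ₜ y) = (s * t) • substLam W p (B x y) := by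
  simp [lamProd, mul_smul]

/-- The `j`-product `u_(j) v`, determined by `u_λ v = ∑ j, (λ ^ j / j!) (u_(j) v)`: it is `j!` times
the coefficient of `λ ^ j`. -/
def jProd (B : U →ₗ[F] V →ₗ[F] F[X] ⊗[F] W) (j : ℕ) : U →ₗ[F] V →ₗ[F] W :=
  (j.factorial : F) •
    B.compr₂ ((TensorProduct.lid F W).toLinearMap ∘ₗ LinearMap.rTensor W (Polynomial.lcoeff F j))

/-- The substitution `λ ↦ -λ - ∂` on `V[λ]`: it sends `∑ λ ^ j v_j` to `∑ (-λ - ∂) ^ j v_j`, where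
`∂` acts on `V`. -/
def substNegLamDel (F : Type u) (V : Type v) [Field F] [AddCommGroup V] [Module F V]
    [Module F[X] V] [IsScalarTower F F[X] V] : F[X] ⊗[F] V →ₗ[F] F[X] ⊗[F] V :=
  TensorProduct.lift
    ((LinearMap.lcomp F (F[X] ⊗[F] V) (TensorProduct.mk F F[X] V 1)) ∘ₗ
      (Polynomial.aeval
        (-(Algebra.lsmul F F (F[X] ⊗[F] V) (Polynomial.X : F[X])) -
          LinearMap.lTensor F[X] (del F V) : Module.End F (F[X] ⊗[F] V))).toLinearMap)

end LambdaMaps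

/-- The variable `λ` of `F[λ, μ]`. -/
abbrev lam (F : Type u) [Field F] : MvPolynomial (Fin 2) F := MvPolynomial.X 0

/-- The variable `μ` of `F[λ, μ]`. -/
abbrev mu (F : Type u) [Field F] : MvPolynomial (Fin 2) F := MvPolynomial.X 1

/-- A Lie conformal algebra structure on an `F[∂]`-module `A`. -/
class LieConformalAlgebra (F : Type u) (A : Type v) [Field F] [AddCommGroup A] [Module F A]
    [Module F[X] A] [IsScalarTower F F[X] A] where
  /-- The `λ`-bracket `a ⊗ b ↦ [a_λ b]`. -/
  bracket : A →ₗ[F] A →ₗ[F] F[X] ⊗[F] A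
  /-- `[∂a_λ b] = -λ [a_λ b]` -/
  bracket_del_left : ∀ a b : A, bracket (del F A a) b = -((Polynomial.X : F[X]) • bracket a b)
  /-- `[a_λ ∂b] = (∂ + λ) [a_λ b]` -/
  bracket_del_right : ∀ a b : A, bracket a (del F A b) =
    LinearMap.lTensor F[X] (del F A) (bracket a b) + (Polynomial.X : F[X]) • bracket a b
  /-- `[a_λ b] = -[b_{-λ-∂} a]` -/
  skew : ∀ a b : A, bracket a b = -(substNegLamDel F A (bracket b a))
  /-- `[a_λ [b_μ c]] = [[a_λ b]_{λ+μ} c] + [b_μ [a_λ c]]` in `A[λ, μ]`. -/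
  jacobi : ∀ a b c : A,
    lamProd bracket (lam F) (1 ⊗ₜ a) (lamProd bracket (mu F) (1 ⊗ₜ b) (1 ⊗ₜ c)) =
      lamProd bracket (lam F + mu F) (lamProd bracket (lam F) (1 ⊗ₜ a) (1 ⊗ₜ b)) (1 ⊗ₜ c) +
      lamProd bracket (mu F) (1 ⊗ₜ b) (lamProd bracket (lam F) (1 ⊗ₜ a) (1 ⊗ₜ c))

/-- A module structure over the Lie conformal algebra `A` on an `F[∂]`-module `M`. -/
class LCModule (F : Type u) (A : Type v) (M : Type w) [Field F]
    [AddCommGroup A] [Module F A] [Module F[X] A] [IsScalarTower F F[X] A]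
    [LieConformalAlgebra F A]
    [AddCommGroup M] [Module F M] [Module F[X] M] [IsScalarTower F F[X] M] where
  /-- The `λ`-action `a ⊗ m ↦ a_λ m`. -/
  act : A →ₗ[F] M →ₗ[F] F[X] ⊗[F] M
  /-- `(∂a)_λ m = -λ a_λ m` -/
  act_del_left : ∀ (a : A) (m : M), act (del F A a) m = -((Polynomial.X : F[X]) • act a m)
  /-- `a_λ (∂m) = (∂ + λ) a_λ m` -/
  act_del_right : ∀ (a : A) (m : M), act a (del F M m) =
    LinearMap.lTensor F[X] (del F M) (act a m) + (Polynomial.X : F[X]) • act a m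
  /-- `a_λ (b_μ m) - b_μ (a_λ m) = [a_λ b]_{λ+μ} m` in `M[λ, μ]`. -/
  jacobi : ∀ (a b : A) (m : M),
    lamProd act (lam F) (1 ⊗ₜ a) (lamProd act (mu F) (1 ⊗ₜ b) (1 ⊗ₜ m)) -
      lamProd act (mu F) (1 ⊗ₜ b) (lamProd act (lam F) (1 ⊗ₜ a) (1 ⊗ₜ m)) =
    lamProd act (lam F + mu F)
      (lamProd (LieConformalAlgebra.bracket (F := F) (A := A)) (lam F) (1 ⊗ₜ a) (1 ⊗ₜ b))
      (1 ⊗ₜ m)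

/-- An endomorphism is diagonalizable when the space is spanned by its eigenvectors. -/
def IsDiagonalizable {F : Type u} {V : Type v} [Field F] [AddCommGroup V] [Module F V]
    (T : Module.End F V) : Prop :=
  ⨆ μ : F, T.eigenspace μ = ⊤

section Virasoro

variable (F : Type u) {A : Type v} [Field F]
variable [AddCommGroup A] [Module F A] [Module F[X] A] [IsScalarTower F F[X] A]
variable [LieConformalAlgebra F A]

/-- `L` is a Virasoro element: `[L_λ L] = (∂ + 2λ) L`, `L_(0) = ∂`, and `L_(1)` is
diagonalizable. -/
structure IsVirasoroElement (L : A) : Prop where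
  bracket_self : LieConformalAlgebra.bracket (F := F) L L =
    (1 : F[X]) ⊗ₜ[F] del F A L + (2 * Polynomial.X : F[X]) ⊗ₜ[F] L
  zero_prod : jProd (LieConformalAlgebra.bracket (F := F) (A := A)) 0 L = del F A
  one_prod : IsDiagonalizable (jProd (LieConformalAlgebra.bracket (F := F) (A := A)) 1 L)

/-- The `A`-module `M` is conformal with respect to `L`: `L_(0)^M = ∂^M`, and `L_(1)^M` is
diagonalizable. -/
structure IsConformalModule (L : A) (M : Type w) [AddCommGroup M] [Module F M] [Module F[X] M]
    [IsScalarTower F F[X] M] [LCModule F A M] : Prop where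
  zero_prod : jProd (LCModule.act (F := F) (A := A) (M := M)) 0 L = del F M
  one_prod : IsDiagonalizable (jProd (LCModule.act (F := F) (A := A) (M := M)) 1 L)

end Virasoro

/-- `F`-linear maps `f : A^{⊗q} → M[λ₁, …, λ_q]`, written as multilinear maps in `q` arguments. For
`q = 0` this is the space `M`. -/
abbrev MultiMaps (F : Type u) (A : Type v) (M : Type w) [Field F] [AddCommGroup A] [Module F A]
    [AddCommGroup M] [Module F M] (q : ℕ) : Type (max u v w) :=
  MultilinearMap F (fun _ : Fin q => A) (MvPolynomial (Fin q) F ⊗[F] M)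

/-- The additive group structure on `MultiMaps`, declared again to help instance search. -/
instance multiMaps_addCommGroup (F : Type u) (A : Type v) (M : Type w) [Field F] [AddCommGroup A]
    [Module F A] [AddCommGroup M] [Module F M] (q : ℕ) : AddCommGroup (MultiMaps F A M q) :=
  inferInstance

section Complex

variable (F : Type u) (A : Type v) (M : Type w) [Field F]
variable [AddCommGroup A] [Module F A] [Module F[X] A] [IsScalarTower F F[X] A]
variable [AddCommGroup M] [Module F M] [Module F[X] M] [IsScalarTower F F[X] M]

/-- The space of `q`-cochains: the `f` that are
* conformally antilinear, `f_λ(a₁, …, ∂a_i, …, a_q) = -λ_i f_λ(a₁, …, a_q)`;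
* skew-symmetric, `f_{λ_σ(1), …, λ_σ(q)}(a_σ(1), …, a_σ(q)) = sign σ • f_λ(a₁, …, a_q)`. -/
def cochains (q : ℕ) : Submodule F (MultiMaps F A M q) where
  carrier := {f |
    (∀ (a : Fin q → A) (i : Fin q), f (Function.update a i (del F A (a i))) =
      -((MvPolynomial.X i : MvPolynomial (Fin q) F) • f a)) ∧
    (∀ (σ : Equiv.Perm (Fin q)) (a : Fin q → A),
      substVars M (fun i => (MvPolynomial.X (σ i) : MvPolynomial (Fin q) F)) (f (a ∘ σ)) =
        ((Equiv.Perm.sign σ : ℤˣ) : ℤ) • f a)}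
  add_mem' := by
    rintro f g ⟨hf, hf2⟩ ⟨hg, hg2⟩
    refine ⟨fun a i => ?_, fun σ a => ?_⟩
    · rw [add_apply, add_apply, hf, hg, smul_add, neg_add]
    · rw [add_apply, add_apply, map_add, hf2, hg2, smul_add]
  zero_mem' := by
    refine ⟨fun a i => ?_, fun σ a => ?_⟩ <;> simp
  smul_mem' := by
    rintro c f ⟨hf, hf2⟩
    refine ⟨fun a i => ?_, fun σ a => ?_⟩
    · rw [smul_apply, smul_apply, hf, smul_neg, smul_comm]
    · rw [smul_apply, smul_apply, map_smul, hf2, smul_comm]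

/-- The operator `∂` on cochains: `(∂f)_λ(a) = (∂^M + ∑ k, λ_k) f_λ(a)`. -/
def delCochain (q : ℕ) : MultiMaps F A M q →ₗ[F] MultiMaps F A M q :=
  LinearMap.compMultilinearMapₗ F
    (LinearMap.lTensor (MvPolynomial (Fin q) F) (del F M) +
      Algebra.lsmul F F (MvPolynomial (Fin q) F ⊗[F] M)
        (∑ k : Fin q, (MvPolynomial.X k : MvPolynomial (Fin q) F)))

variable {F A M}

/-- The part
`∑ k, (-1) ^ (k + 1) a_{k λ_k} f_{λ₁, …, λ̂_k, …, λ_{q+1}}(a₁, …, â_k, …, a_{q+1})`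
of the differential (the signs are those of the formula with indices starting at `1`). -/
def actionPart [LieConformalAlgebra F A] [LCModule F A M] {q : ℕ} (f : MultiMaps F A M q) :
    MultiMaps F A M (q + 1) :=
  ∑ k : Fin (q + 1), (-1 : ℤ) ^ (k : ℕ) •
    LinearMap.uncurryMid (M := fun _ : Fin (q + 1) => A) k
      { toFun := fun x =>
          (((lamProd (LCModule.act (F := F) (A := A) (M := M))
              (MvPolynomial.X k : MvPolynomial (Fin (q + 1)) F) (1 ⊗ₜ x)).restrictScalars F) ∘ₗ
            substVars M (fun j => (MvPolynomial.X (k.succAbove j) : MvPolynomial (Fin (q + 1)) F))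
          ).compMultilinearMap f
        map_add' := fun x y => by
          ext a
          simp [TensorProduct.tmul_add]
        map_smul' := fun c x => by
          ext a
          simp [TensorProduct.tmul_smul] }

instance multilinearMap_isScalarTower {P : Type*} [CommRing P] [Algebra F P] {q : ℕ} :
    IsScalarTower F P (MultilinearMap F (fun _ : Fin q => A) (P ⊗[F] M)) :=
  ⟨fun c p f => by
    ext a
    simp [smul_assoc]⟩

/-- `f_{p₁, …, p_{q+1}}(x, a₁, …, a_q)` for values `p i` in a commutative `F`-algebra `P`,
extended `P`-linearly to `x ∈ P ⊗ A`, as a multilinear map in `a₁, …, a_q`. -/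
def insertFirst {P : Type*} [CommRing P] [Algebra F P] {q : ℕ} (f : MultiMaps F A M (q + 1))
    (p : Fin (q + 1) → P) :
    P ⊗[F] A →ₗ[P] MultilinearMap F (fun _ : Fin q => A) (P ⊗[F] M) :=
  LinearMap.liftBaseChange P
    (LinearMap.compMultilinearMapₗ F (substVars M p) ∘ₗ
      MultilinearMap.curryLeft f)

theorem insertFirst_tmul {P : Type*} [CommRing P] [Algebra F P] {q : ℕ}
    (f : MultiMaps F A M (q + 1)) (p : Fin (q + 1) → P) (s : P) (x : A) (a : Fin q → A) :
    insertFirst f p (s ⊗ₜ x) a = s • substVars M p (f (Fin.cons x a)) := by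
  simp [insertFirst]

theorem insertFirst_add {P : Type*} [CommRing P] [Algebra F P] {q : ℕ}
    (f g : MultiMaps F A M (q + 1)) (p : Fin (q + 1) → P) (x : P ⊗[F] A) (a : Fin q → A) :
    insertFirst (f + g) p x a = insertFirst f p x a + insertFirst g p x a := by
  induction x with
  | zero => simp
  | tmul s y => simp [insertFirst_tmul]
  | add y z hy hz => simp only [map_add, add_apply, hy, hz]; abel

theorem insertFirst_smul {P : Type*} [CommRing P] [Algebra F P] {q : ℕ} (c : F)
    (f : MultiMaps F A M (q + 1)) (p : Fin (q + 1) → P) (x : P ⊗[F] A) (a : Fin q → A) :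
    insertFirst (c • f) p x a = c • insertFirst f p x a := by
  induction x with
  | zero => simp
  | tmul s y => rw [insertFirst_tmul, insertFirst_tmul, smul_apply, map_smul, smul_comm]
  | add y z hy hz => simp only [map_add, add_apply, hy, hz, smul_add]

/-- The part
`∑ k < l, (-1) ^ (k + l) f_{λ_k + λ_l, λ₁, …, λ̂_k, …, λ̂_l, …}([a_{k λ_k} a_l], a₁, …, â_k, …, â_l, …)`
of the differential of a `(q + 1)`-cochain. Here `l` runs over the `q + 2` arguments and `k` over the
`q + 1` arguments that remain when the `l`-th is deleted. -/
def bracketPart [LieConformalAlgebra F A] {q : ℕ} (f : MultiMaps F A M (q + 1)) :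
    MultiMaps F A M (q + 2) :=
  ∑ l : Fin (q + 2), ∑ k : Fin (q + 1), if k.castSucc < l then
    (-1 : ℤ) ^ ((k : ℕ) + (l : ℕ)) •
      LinearMap.uncurryMid (M := fun _ : Fin (q + 2) => A) l
        { toFun := fun y =>
            LinearMap.uncurryMid (M := fun _ : Fin (q + 1) => A) k
              ((insertFirst f (Fin.cons (MvPolynomial.X k.castSucc + MvPolynomial.X l)
                  (fun j => MvPolynomial.X (l.succAbove (k.succAbove j))) :
                  Fin (q + 1) → MvPolynomial (Fin (q + 2)) F)).restrictScalars F ∘ₗ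
                ((lamProd (LieConformalAlgebra.bracket (F := F) (A := A))
                  (MvPolynomial.X k.castSucc : MvPolynomial (Fin (q + 2)) F)).flip
                    (1 ⊗ₜ y)).restrictScalars F ∘ₗ
                TensorProduct.mk F (MvPolynomial (Fin (q + 2)) F) A 1)
          map_add' := fun x y => by
            ext a
            simp [TensorProduct.tmul_add]
          map_smul' := fun c x => by
            ext a
            simp [TensorProduct.tmul_smul] }
  else 0

theorem actionPart_apply [LieConformalAlgebra F A] [LCModule F A M] {q : ℕ}
    (f : MultiMaps F A M q) (a : Fin (q + 1) → A) :
    actionPart f a = ∑ k : Fin (q + 1), (-1 : ℤ) ^ (k : ℕ) •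
      lamProd (LCModule.act (F := F) (A := A) (M := M))
        (MvPolynomial.X k : MvPolynomial (Fin (q + 1)) F) (1 ⊗ₜ a k)
        (substVars M (fun j => (MvPolynomial.X (k.succAbove j) : MvPolynomial (Fin (q + 1)) F))
          (f (fun j => a (k.succAbove j)))) := by
  simp only [actionPart, sum_apply]
  rfl

theorem bracketPart_apply [LieConformalAlgebra F A] {q : ℕ} (f : MultiMaps F A M (q + 1))
    (a : Fin (q + 2) → A) :
    bracketPart f a = ∑ l : Fin (q + 2), ∑ k : Fin (q + 1), if k.castSucc < l then
      (-1 : ℤ) ^ ((k : ℕ) + (l : ℕ)) •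
        insertFirst f (Fin.cons (MvPolynomial.X k.castSucc + MvPolynomial.X l)
            (fun j => MvPolynomial.X (l.succAbove (k.succAbove j))) :
            Fin (q + 1) → MvPolynomial (Fin (q + 2)) F)
          (lamProd (LieConformalAlgebra.bracket (F := F) (A := A))
            (MvPolynomial.X k.castSucc : MvPolynomial (Fin (q + 2)) F)
            (1 ⊗ₜ a k.castSucc) (1 ⊗ₜ a l))
          (fun j => a (l.succAbove (k.succAbove j)))
      else 0 := by
  simp only [bracketPart, sum_apply]
  refine Finset.sum_congr rfl fun l _ => Finset.sum_congr rfl fun k _ => ?_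
  split_ifs with h
  · rw [smul_apply]
    congr 1
    have e : l.succAbove k = k.castSucc := Fin.succAbove_of_castSucc_lt l k h
    simp [Fin.removeNth, e]
    rfl
  · rfl

variable (F A M)

/-- The differential `d` of the basic complex (defined on all multilinear maps). On `0`-cochains it is
`(dm)_λ(a) = a_λ m`, as the second sum is empty. -/
def differential [LieConformalAlgebra F A] [LCModule F A M] :
    (q : ℕ) → MultiMaps F A M q →ₗ[F] MultiMaps F A M (q + 1)
  | 0 =>
    { toFun := fun f => actionPart f
      map_add' := fun f g => by
        ext a
        simp [actionPart_apply, Finset.sum_add_distrib]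
      map_smul' := fun c f => by
        ext a
        simp [actionPart_apply, smul_comm] }
  | q + 1 =>
    { toFun := fun f => actionPart f + bracketPart f
      map_add' := fun f g => by
        ext a
        simp only [add_apply, actionPart_apply, bracketPart_apply, insertFirst_add, map_add,
          smul_add, Finset.sum_add_distrib, ← add_assoc, ite_add_zero]
        abel
      map_smul' := fun c f => by
        ext a
        simp only [add_apply, smul_apply, actionPart_apply, bracketPart_apply, insertFirst_smul,
          map_smul, RingHom.id_apply, smul_add, Finset.smul_sum, smul_ite, smul_zero,
          LinearMap.map_smul_of_tower, smul_comm c] }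

end Complex

section Preserve
variable {F : Type u} {A : Type v} {M : Type w} [Field F]
variable {U : Type*} [AddCommGroup U] [Module F U]
variable {V : Type*} [AddCommGroup V] [Module F V]
variable {W : Type*} [AddCommGroup W] [Module F W]
variable {P : Type*} [CommRing P] [Algebra F P] {Q : Type*} [CommRing Q] [Algebra F Q]

theorem rTensor_smul (φ : P →ₐ[F] Q) (s : P) (z : P ⊗[F] W) :
    LinearMap.rTensor W φ.toLinearMap (s • z) = φ s • LinearMap.rTensor W φ.toLinearMap z := by
  induction z with
  | zero => simp
  | tmul t y => simp [TensorProduct.smul_tmul']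
  | add y z hy hz => simp only [map_add, smul_add, hy, hz]

theorem rTensor_substLam (φ : P →ₐ[F] Q) (p : P) (z : F[X] ⊗[F] W) :
    LinearMap.rTensor W φ.toLinearMap (substLam W p z) = substLam W (φ p) z := by
  induction z with
  | zero => simp
  | tmul t y => simp [substLam, Polynomial.aeval_algHom_apply]
  | add y z hy hz => simp only [map_add, hy, hz]

theorem rTensor_substVars (φ : P →ₐ[F] Q) {q : ℕ} (p : Fin q → P)
    (z : MvPolynomial (Fin q) F ⊗[F] W) :
    LinearMap.rTensor W φ.toLinearMap (substVars W p z) = substVars W (fun i => φ (p i)) z := by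
  induction z with
  | zero => simp
  | tmul t y =>
    simp only [substVars, LinearMap.rTensor_tmul, AlgHom.toLinearMap_apply]
    rw [← MvPolynomial.comp_aeval_apply]
  | add y z hy hz => simp only [map_add, hy, hz]

theorem rTensor_lamProd (φ : P →ₐ[F] Q) (B : U →ₗ[F] V →ₗ[F] F[X] ⊗[F] W) (p : P)
    (x : P ⊗[F] U) (y : P ⊗[F] V) :
    LinearMap.rTensor W φ.toLinearMap (lamProd B p x y) =
      lamProd B (φ p) (LinearMap.rTensor U φ.toLinearMap x)
        (LinearMap.rTensor V φ.toLinearMap y) := by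
  induction x with
  | zero => simp
  | tmul s x =>
    induction y with
    | zero => simp
    | tmul t y => simp [lamProd_tmul, rTensor_smul, rTensor_substLam]
    | add y z hy hz => simp only [map_add, hy, hz]
  | add y z hy hz => simp only [map_add, hy, hz, LinearMap.add_apply]

theorem substLam_smul (p : P) (s : F[X]) (z : F[X] ⊗[F] W) :
    substLam W p (s • z) = Polynomial.aeval p s • substLam W p z :=
  rTensor_smul (Polynomial.aeval p) s z

theorem substVars_smul {q : ℕ} (p : Fin q → P) (s : MvPolynomial (Fin q) F)
    (z : MvPolynomial (Fin q) F ⊗[F] W) :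
    substVars W p (s • z) = MvPolynomial.aeval p s • substVars W p z :=
  rTensor_smul (MvPolynomial.aeval p) s z

theorem substLam_lTensor (p : P) (T : V →ₗ[F] W) (z : F[X] ⊗[F] V) :
    substLam W p (LinearMap.lTensor F[X] T z) = LinearMap.lTensor P T (substLam V p z) := by
  induction z with
  | zero => simp
  | tmul t y => simp [substLam]
  | add y z hy hz => simp only [map_add, hy, hz]

theorem substVars_lTensor {q : ℕ} (p : Fin q → P) (T : V →ₗ[F] W)
    (z : MvPolynomial (Fin q) F ⊗[F] V) :
    substVars W p (LinearMap.lTensor _ T z) = LinearMap.lTensor P T (substVars V p z) := by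
  induction z with
  | zero => simp
  | tmul t y => simp [substVars]
  | add y z hy hz => simp only [map_add, hy, hz]

theorem lTensor_smul' (T : V →ₗ[F] W) (s : P) (z : P ⊗[F] V) :
    LinearMap.lTensor P T (s • z) = s • LinearMap.lTensor P T z := by
  induction z with
  | zero => simp
  | tmul t y => simp [TensorProduct.smul_tmul']
  | add y z hy hz => simp only [map_add, smul_add, hy, hz]

theorem exists_perm_succAbove {n : ℕ} (σ : Equiv.Perm (Fin (n + 1))) (k : Fin (n + 1)) :
    ∃ ρ : Equiv.Perm (Fin n), (∀ j, σ (k.succAbove j) = (σ k).succAbove (ρ j)) ∧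
      ((Equiv.Perm.sign σ : ℤˣ) : ℤ) * (-1) ^ (k : ℕ) =
        (-1) ^ ((σ k : Fin (n + 1)) : ℕ) * ((Equiv.Perm.sign ρ : ℤˣ) : ℤ) := by
  let π : Equiv.Perm (Fin (n + 1)) := k.cycleRange.symm.trans (σ.trans (σ k).cycleRange)
  have h0 : π 0 = 0 := by simp [π]
  obtain ⟨⟨p, ρ⟩, hρ⟩ := Equiv.Perm.decomposeFin.symm.surjective π
  have hp : p = 0 := by
    have := congrArg (fun e => e 0) hρ
    simpa [h0] using this
  subst hp
  have hs : ∀ j, π (Fin.succ j) = (ρ j).succ := by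
    intro j
    rw [← hρ]; simp
  refine ⟨ρ, fun j => ?_, ?_⟩
  · have := hs j
    simp only [π, Equiv.trans_apply, Fin.cycleRange_symm_succ] at this
    rw [← Fin.cycleRange_symm_succ (σ k), ← this]; simp
  · have h1 : Equiv.Perm.sign π = Equiv.Perm.sign ρ := by
      rw [← hρ]; simp
    have h2 : Equiv.Perm.sign π = (-1) ^ (k : ℕ) * Equiv.Perm.sign σ * (-1) ^ ((σ k : Fin _) : ℕ) := by
      simp only [π, Equiv.Perm.sign_trans, Equiv.Perm.sign_symm, Fin.sign_cycleRange]
      ac_rfl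
    rw [← h1, h2]
    push_cast
    have : ((-1 : ℤ) ^ ((σ k : Fin _) : ℕ)) * (-1 : ℤ) ^ ((σ k : Fin _) : ℕ) = 1 := by
      rw [← mul_pow]; simp
    linear_combination (-((Equiv.Perm.sign σ : ℤˣ) : ℤ) * (-1) ^ (k : ℕ)) * this

variable [AddCommGroup A] [Module F A] [Module F[X] A] [IsScalarTower F F[X] A]
variable [AddCommGroup M] [Module F M] [Module F[X] M] [IsScalarTower F F[X] M]

theorem cochain_del {q : ℕ} {f : MultiMaps F A M q} (hf : f ∈ cochains F A M q)
    (p : Fin q → P) (a : Fin q → A) (i : Fin q) :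
    substVars M p (f (Function.update a i (del F A (a i)))) = -(p i • substVars M p (f a)) := by
  rw [hf.1, map_neg, substVars_smul, MvPolynomial.aeval_X]

theorem cochain_perm {q : ℕ} {f : MultiMaps F A M q} (hf : f ∈ cochains F A M q)
    (p : Fin q → P) (σ : Equiv.Perm (Fin q)) (a : Fin q → A) :
    substVars M (fun i => p (σ i)) (f (a ∘ σ)) =
      ((Equiv.Perm.sign σ : ℤˣ) : ℤ) • substVars M p (f a) := by
  have := congrArg (substVars M p) (hf.2 σ a)
  rw [map_zsmul] at this
  rw [← this]
  have := rTensor_substVars (MvPolynomial.aeval p : MvPolynomial (Fin q) F →ₐ[F] P)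
    (fun i => (MvPolynomial.X (σ i) : MvPolynomial (Fin q) F)) (f (a ∘ σ))
  simp only [MvPolynomial.aeval_X] at this
  exact this.symm

theorem delCochain_apply {q : ℕ} (f : MultiMaps F A M q) (a : Fin q → A) :
    delCochain F A M q f a = LinearMap.lTensor (MvPolynomial (Fin q) F) (del F M) (f a) +
      (∑ k : Fin q, (MvPolynomial.X k : MvPolynomial (Fin q) F)) • f a := rfl

theorem delCochain_mem {q : ℕ} {f : MultiMaps F A M q}
    (hf : f ∈ cochains F A M q) : delCochain F A M q f ∈ cochains F A M q := by
  refine ⟨fun a i => ?_, fun σ a => ?_⟩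
  · rw [delCochain_apply, delCochain_apply, hf.1, map_neg, lTensor_smul', smul_add, smul_neg,
      smul_comm (MvPolynomial.X i : MvPolynomial (Fin q) F) (∑ k : Fin q, _), neg_add]
  · rw [delCochain_apply, delCochain_apply, map_add, substVars_lTensor, substVars_smul, hf.2,
      map_zsmul, smul_add, map_sum]
    simp only [MvPolynomial.aeval_X]
    rw [Equiv.sum_comp σ (fun k => (MvPolynomial.X k : MvPolynomial (Fin q) F)), smul_comm]

variable [LieConformalAlgebra F A] [LCModule F A M]

theorem actionPart_perm {q : ℕ} {f : MultiMaps F A M q} (hf : f ∈ cochains F A M q)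
    (σ : Equiv.Perm (Fin (q + 1))) (a : Fin (q + 1) → A) :
    substVars M (fun i => (MvPolynomial.X (σ i) : MvPolynomial (Fin (q + 1)) F))
      (actionPart f (a ∘ σ)) = ((Equiv.Perm.sign σ : ℤˣ) : ℤ) • actionPart f a := by
  rw [actionPart_apply, actionPart_apply, map_sum, Finset.smul_sum]
  conv_rhs => rw [← Equiv.sum_comp σ]
  refine Finset.sum_congr rfl fun k _ => ?_
  obtain ⟨ρ, h1, h2⟩ := exists_perm_succAbove σ k
  rw [map_zsmul]
  conv_lhs => rw [substVars, rTensor_lamProd]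
  simp only [LinearMap.rTensor_tmul, AlgHom.toLinearMap_apply, map_one, MvPolynomial.aeval_X,
    rTensor_substVars, Function.comp_apply, h1]
  have := cochain_perm hf (fun j => (MvPolynomial.X ((σ k).succAbove j) :
    MvPolynomial (Fin (q + 1)) F)) ρ (fun j => a ((σ k).succAbove j))
  simp only [Function.comp_def] at this
  rw [this, map_zsmul, smul_smul, smul_smul]
  congr 1
  have e1 : ((Equiv.Perm.sign ρ : ℤˣ) : ℤ) * ((Equiv.Perm.sign ρ : ℤˣ) : ℤ) = 1 := by
    rw [← Units.val_mul, Int.units_mul_self]; rfl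
  have e2 : ((Equiv.Perm.sign σ : ℤˣ) : ℤ) * ((Equiv.Perm.sign σ : ℤˣ) : ℤ) = 1 := by
    rw [← Units.val_mul, Int.units_mul_self]; rfl
  linear_combination ((Equiv.Perm.sign ρ : ℤˣ) : ℤ) * ((Equiv.Perm.sign σ : ℤˣ) : ℤ) * h2 - (-1) ^ (k : ℕ) *
    ((Equiv.Perm.sign ρ : ℤˣ) : ℤ) * e2 + (-1) ^ ((σ k : Fin _) : ℕ) * ((Equiv.Perm.sign σ : ℤˣ) : ℤ) * e1


/-- The summand of the second sum of the differential for the arguments `x`, `y` and the remaining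
ones `r`. -/
def brTerm {q n : ℕ} (f : MultiMaps F A M (q + 1)) (x y : Fin n) (r : Fin q → Fin n)
    (a : Fin n → A) : MvPolynomial (Fin n) F ⊗[F] M :=
  insertFirst f (Fin.cons (MvPolynomial.X x + MvPolynomial.X y) (fun j => MvPolynomial.X (r j)) :
      Fin (q + 1) → MvPolynomial (Fin n) F)
    (lamProd (LieConformalAlgebra.bracket (F := F) (A := A))
      (MvPolynomial.X x : MvPolynomial (Fin n) F) (1 ⊗ₜ a x) (1 ⊗ₜ a y))
    (fun j => a (r j))

theorem rTensor_insertFirst {q : ℕ} (f : MultiMaps F A M (q + 1)) (φ : P →ₐ[F] Q)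
    (p : Fin (q + 1) → P) (x : P ⊗[F] A) (a : Fin q → A) :
    LinearMap.rTensor M φ.toLinearMap (insertFirst f p x a) =
      insertFirst f (fun i => φ (p i)) (LinearMap.rTensor A φ.toLinearMap x) a := by
  induction x with
  | zero => simp
  | tmul s y => simp [insertFirst_tmul, rTensor_smul, rTensor_substVars]
  | add y z hy hz => simp only [map_add, add_apply, hy, hz]

theorem brTerm_rename {q n : ℕ} (f : MultiMaps F A M (q + 1)) (x y : Fin n) (r : Fin q → Fin n)
    (a : Fin n → A) (σ : Equiv.Perm (Fin n)) :
    substVars M (fun i => (MvPolynomial.X (σ i) : MvPolynomial (Fin n) F))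
      (brTerm f x y r (a ∘ σ)) = brTerm f (σ x) (σ y) (fun j => σ (r j)) a := by
  rw [brTerm, substVars, rTensor_insertFirst, rTensor_lamProd, brTerm]
  simp only [LinearMap.rTensor_tmul, AlgHom.toLinearMap_apply, map_one, MvPolynomial.aeval_X,
    Function.comp_apply]
  congr 3
  ext i : 1
  refine Fin.cases ?_ (fun j => ?_) i <;> simp

theorem insertFirst_perm {q : ℕ} {f : MultiMaps F A M (q + 1)}
    (hf : f ∈ cochains F A M (q + 1)) (p0 : P) (p : Fin q → P) (ρ : Equiv.Perm (Fin q))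
    (x : P ⊗[F] A) (a : Fin q → A) :
    insertFirst f (Fin.cons p0 (fun j => p (ρ j)) : Fin (q + 1) → P) x (fun j => a (ρ j)) =
      ((Equiv.Perm.sign ρ : ℤˣ) : ℤ) • insertFirst f (Fin.cons p0 p : Fin (q + 1) → P) x a := by
  induction x with
  | zero => simp
  | tmul s y =>
    rw [insertFirst_tmul, insertFirst_tmul, smul_comm]
    congr 1
    have := cochain_perm hf (Fin.cons p0 p : Fin (q + 1) → P)
      (Equiv.Perm.decomposeFin.symm (0, ρ)) (Fin.cons y a)
    rw [Equiv.Perm.decomposeFin.symm_sign, if_pos rfl, one_mul] at this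
    rw [← this]
    congr 2
    · congr 1
      ext i : 1
      refine Fin.cases ?_ (fun j => ?_) i <;> simp
    · ext i : 1
      refine Fin.cases ?_ (fun j => ?_) i <;> simp
  | add y z hy hz => simp only [map_add, add_apply, hy, hz, smul_add]

theorem insertFirst_lTensor_del {q : ℕ} {f : MultiMaps F A M (q + 1)}
    (hf : f ∈ cochains F A M (q + 1)) (p : Fin (q + 1) → P) (x : P ⊗[F] A) (a : Fin q → A) :
    insertFirst f p (LinearMap.lTensor P (del F A) x) a = -(p 0 • insertFirst f p x a) := by
  induction x with
  | zero => simp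
  | tmul s y =>
    have := cochain_del hf p (Fin.cons y a) 0
    simp only [Fin.cons_zero, Fin.update_cons_zero] at this
    rw [LinearMap.lTensor_tmul, insertFirst_tmul, insertFirst_tmul, this, smul_neg, smul_comm]
  | add y z hy hz => simp only [map_add, add_apply, hy, hz, smul_add, neg_add]

theorem insertFirst_substNegLamDel {q : ℕ} {f : MultiMaps F A M (q + 1)}
    (hf : f ∈ cochains F A M (q + 1)) (s t : P) (p : Fin q → P) (z : F[X] ⊗[F] A)
    (a : Fin q → A) :
    insertFirst f (Fin.cons (s + t) p : Fin (q + 1) → P) (substLam A s (substNegLamDel F A z)) a =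
      insertFirst f (Fin.cons (s + t) p : Fin (q + 1) → P) (substLam A t z) a := by
  have key : ∀ w : F[X] ⊗[F] A,
      insertFirst f (Fin.cons (s + t) p : Fin (q + 1) → P) (substLam A s
        ((-(Algebra.lsmul F F (F[X] ⊗[F] A) (Polynomial.X : F[X])) -
          LinearMap.lTensor F[X] (del F A) : Module.End F (F[X] ⊗[F] A)) w)) a =
      t • insertFirst f (Fin.cons (s + t) p : Fin (q + 1) → P) (substLam A s w) a := by
    intro w
    simp only [LinearMap.sub_apply, LinearMap.neg_apply, Algebra.lsmul_coe, map_sub, map_neg,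
      substLam_smul, Polynomial.aeval_X, substLam_lTensor]
    rw [sub_apply, neg_apply, insertFirst_lTensor_del hf, map_smul, smul_apply]
    simp only [Fin.cons_zero, add_smul]
    abel
  induction z with
  | zero => simp
  | tmul r y =>
    simp only [substNegLamDel, TensorProduct.lift.tmul, LinearMap.comp_apply,
      LinearMap.lcomp_apply, AlgHom.toLinearMap_apply, TensorProduct.mk_apply]
    induction r using Polynomial.induction_on' with
    | add r r' h h' =>
      simp only [map_add, LinearMap.add_apply, add_apply, TensorProduct.add_tmul, h, h']
    | monomial n c =>
      induction n with
      | zero =>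
        simp [substLam, Algebra.algebraMap_eq_smul_one, insertFirst_tmul]
      | succ n ih =>
        have e : (Polynomial.monomial (n + 1) c : F[X]) = Polynomial.X * Polynomial.monomial n c := by
          rw [Polynomial.X_mul_monomial]
        rw [e, map_mul, Polynomial.aeval_X, Module.End.mul_apply, key, ih,
          ← smul_eq_mul, ← TensorProduct.smul_tmul', substLam_smul, Polynomial.aeval_X, map_smul,
          smul_apply]
  | add y z hy hz => simp only [map_add, add_apply, hy, hz]

theorem brTerm_swap {q n : ℕ} {f : MultiMaps F A M (q + 1)} (hf : f ∈ cochains F A M (q + 1))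
    (x y : Fin n) (r : Fin q → Fin n) (a : Fin n → A) :
    brTerm f y x r a = -brTerm f x y r a := by
  rw [brTerm, brTerm, lamProd_tmul, lamProd_tmul, LieConformalAlgebra.skew (a y) (a x), map_neg,
    one_mul, one_smul, one_smul, map_neg, neg_apply, insertFirst_substNegLamDel hf,
    add_comm (MvPolynomial.X y)]

theorem bracketPart_two {q : ℕ} {f : MultiMaps F A M (q + 1)} (hf : f ∈ cochains F A M (q + 1))
    (a : Fin (q + 2) → A) :
    (2 : ℤ) • bracketPart f a = ∑ l : Fin (q + 2), ∑ k : Fin (q + 1),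
      (-1 : ℤ) ^ ((k : ℕ) + (l : ℕ)) •
        brTerm f (l.succAbove k) l (fun j => l.succAbove (k.succAbove j)) a := by
  have hB : bracketPart f a = ∑ p : Fin (q + 2) × Fin (q + 1) with p.2.castSucc < p.1,
      (-1 : ℤ) ^ ((p.2 : ℕ) + (p.1 : ℕ)) •
        brTerm f (p.1.succAbove p.2) p.1 (fun j => p.1.succAbove (p.2.succAbove j)) a := by
    rw [bracketPart_apply, ← Finset.sum_product', Finset.univ_product_univ, Finset.sum_filter]
    refine Finset.sum_congr rfl fun p _ => ?_
    split_ifs with h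
    · rw [Fin.succAbove_of_castSucc_lt _ _ h]
      rfl
    · rfl
  rw [← Finset.sum_product', Finset.univ_product_univ,
    ← Finset.sum_filter_add_sum_filter_not Finset.univ
      (fun p : Fin (q + 2) × Fin (q + 1) => p.2.castSucc < p.1), ← hB, two_zsmul]
  congr 1
  rw [hB]
  symm
  refine Finset.sum_bij (fun p hp => (p.2.succ, ⟨(p.1 : ℕ), ?_⟩)) ?_ ?_ ?_ ?_
  · have := (Finset.mem_filter.1 hp).2
    have h2 := p.2.2
    simp only [Fin.lt_def, Fin.val_castSucc] at this
    omega
  · intro p hp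
    have := (Finset.mem_filter.1 hp).2
    simp only [Finset.mem_filter, Finset.mem_univ, true_and, Fin.lt_def, Fin.val_castSucc,
      Fin.val_succ] at this ⊢
    omega
  · intro p hp p' hp' h
    simp only [Prod.mk.injEq, Fin.mk.injEq, Fin.succ_inj] at h
    exact Prod.ext (Fin.ext h.2) h.1
  · intro p hp
    have := (Finset.mem_filter.1 hp).2
    have hne : p.1 ≠ 0 := Fin.ne_zero_of_lt this
    refine ⟨(p.2.castSucc, p.1.pred hne), ?_, ?_⟩
    · simp only [Finset.mem_filter, Finset.mem_univ, true_and, Fin.lt_def, Fin.val_castSucc,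
        Fin.val_pred] at this ⊢
      omega
    · simp
  · rintro ⟨l, k⟩ hp
    have h : ¬ k.castSucc < l := (Finset.mem_filter.1 hp).2
    have hl : (l : ℕ) < q + 1 := by
      have := k.2
      simp only [Fin.lt_def, Fin.val_castSucc] at h
      omega
    have h' : l ≤ k.castSucc := not_lt.1 h
    have e1 : l.succAbove k = k.succ := Fin.succAbove_of_le_castSucc _ _ h'
    have e2 : k.succ.succAbove ⟨(l : ℕ), hl⟩ = l := by
      rw [Fin.succAbove_of_castSucc_lt]
      · ext; rfl
      · simp only [Fin.lt_def, Fin.le_def, Fin.val_castSucc, Fin.val_succ] at h' ⊢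
        omega
    have e3 : (fun j => l.succAbove (k.succAbove j)) =
        fun j => k.succ.succAbove ((⟨(l : ℕ), hl⟩ : Fin (q + 1)).succAbove j) := by
      funext j
      ext
      simp only [Fin.le_def, Fin.val_castSucc] at h'
      simp only [Fin.succAbove, Fin.lt_def]
      split_ifs <;> simp_all <;> omega
    simp only
    rw [e1, e2, e3, brTerm_swap hf, smul_neg, ← neg_smul]
    congr 1
    simp only [Fin.val_succ]
    ring

theorem bracketPart_perm [CharZero F] {q : ℕ} {f : MultiMaps F A M (q + 1)}
    (hf : f ∈ cochains F A M (q + 1))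
    (σ : Equiv.Perm (Fin (q + 2))) (a : Fin (q + 2) → A) :
    substVars M (fun i => (MvPolynomial.X (σ i) : MvPolynomial (Fin (q + 2)) F))
      (bracketPart f (a ∘ σ)) = ((Equiv.Perm.sign σ : ℤˣ) : ℤ) • bracketPart f a := by
  have h2 : ((2 : ℤ) : F) ≠ 0 := by norm_num
  have inj : ∀ u v : MvPolynomial (Fin (q + 2)) F ⊗[F] M, (2 : ℤ) • u = (2 : ℤ) • v → u = v := by
    intro u v h
    rw [← Int.cast_smul_eq_zsmul F, ← Int.cast_smul_eq_zsmul F] at h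
    exact smul_right_injective _ h2 h
  apply inj
  rw [← map_zsmul, smul_comm, bracketPart_two hf, bracketPart_two hf, map_sum, Finset.smul_sum]
  conv_rhs => rw [← Equiv.sum_comp σ]
  refine Finset.sum_congr rfl fun l _ => ?_
  obtain ⟨ρ, h1, h2⟩ := exists_perm_succAbove σ l
  rw [map_sum, Finset.smul_sum]
  conv_rhs => rw [← Equiv.sum_comp ρ]
  refine Finset.sum_congr rfl fun k _ => ?_
  obtain ⟨τ, h3, h4⟩ := exists_perm_succAbove ρ k
  rw [map_zsmul, brTerm_rename]
  simp only [h1, h3]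
  have := insertFirst_perm hf (MvPolynomial.X ((σ l).succAbove (ρ k)) + MvPolynomial.X (σ l))
    (fun j => (MvPolynomial.X ((σ l).succAbove ((ρ k).succAbove j)) :
      MvPolynomial (Fin (q + 2)) F)) τ (lamProd (LieConformalAlgebra.bracket (F := F) (A := A))
      (MvPolynomial.X ((σ l).succAbove (ρ k)) : MvPolynomial (Fin (q + 2)) F)
      (1 ⊗ₜ a ((σ l).succAbove (ρ k))) (1 ⊗ₜ a (σ l)))
      (fun j => a ((σ l).succAbove ((ρ k).succAbove j)))
  rw [brTerm, brTerm, this, smul_smul, smul_smul]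
  congr 1
  have e1 : ((Equiv.Perm.sign ρ : ℤˣ) : ℤ) * ((Equiv.Perm.sign ρ : ℤˣ) : ℤ) = 1 := by
    rw [← Units.val_mul, Int.units_mul_self]; rfl
  have e2 : ((Equiv.Perm.sign σ : ℤˣ) : ℤ) * ((Equiv.Perm.sign σ : ℤˣ) : ℤ) = 1 := by
    rw [← Units.val_mul, Int.units_mul_self]; rfl
  have e3 : ((Equiv.Perm.sign τ : ℤˣ) : ℤ) * ((Equiv.Perm.sign τ : ℤˣ) : ℤ) = 1 := by
    rw [← Units.val_mul, Int.units_mul_self]; rfl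
  have m : ∀ n : ℕ, (-1 : ℤ) ^ n * (-1) ^ n = 1 := fun n => by rw [← mul_pow]; simp
  rw [pow_add, pow_add]
  rcases Int.units_eq_one_or (Equiv.Perm.sign ρ) with r1 | r1 <;>
  rcases Int.units_eq_one_or (Equiv.Perm.sign σ) with r2 | r2 <;>
  rcases Int.units_eq_one_or (Equiv.Perm.sign τ) with r3 | r3 <;>
  simp only [r1, r2, r3, Units.val_one, Units.val_neg] at h2 h4 ⊢ <;>
  linarith [congrArg₂ (· * ·) h2 h4]


theorem lamProd_act_del_left (p : P) (x : A) (z : P ⊗[F] M) :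
    lamProd (LCModule.act (F := F) (A := A) (M := M)) p (1 ⊗ₜ del F A x) z =
      -(p • lamProd (LCModule.act (F := F) (A := A) (M := M)) p (1 ⊗ₜ x) z) := by
  induction z with
  | zero => simp
  | tmul s y =>
    rw [lamProd_tmul, lamProd_tmul, LCModule.act_del_left, map_neg, substLam_smul,
      Polynomial.aeval_X, smul_neg, smul_comm]
  | add y z hy hz => simp only [map_add, hy, hz, smul_add, neg_add]

theorem lamProd_act_del_right (p : P) (x : A) (z : P ⊗[F] M) :
    lamProd (LCModule.act (F := F) (A := A) (M := M)) p (1 ⊗ₜ x)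
        (LinearMap.lTensor P (del F M) z) =
      LinearMap.lTensor P (del F M)
        (lamProd (LCModule.act (F := F) (A := A) (M := M)) p (1 ⊗ₜ x) z) +
      p • lamProd (LCModule.act (F := F) (A := A) (M := M)) p (1 ⊗ₜ x) z := by
  induction z with
  | zero => simp
  | tmul s y =>
    rw [LinearMap.lTensor_tmul, lamProd_tmul, lamProd_tmul, LCModule.act_del_right, map_add,
      substLam_smul, Polynomial.aeval_X, smul_add, substLam_lTensor, lTensor_smul', smul_comm p]
  | add y z hy hz => 
    simp only [map_add, hy, hz, smul_add]
    abel

theorem lamProd_bracket_del_left (p : P) (x y : A) :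
    lamProd (LieConformalAlgebra.bracket (F := F) (A := A)) p (1 ⊗ₜ del F A x) (1 ⊗ₜ y) =
      -(p • lamProd (LieConformalAlgebra.bracket (F := F) (A := A)) p (1 ⊗ₜ x) (1 ⊗ₜ y)) := by
  rw [lamProd_tmul, lamProd_tmul, LieConformalAlgebra.bracket_del_left, map_neg, substLam_smul,
    Polynomial.aeval_X, smul_neg, smul_comm]

theorem lamProd_bracket_del_right (p : P) (x y : A) :
    lamProd (LieConformalAlgebra.bracket (F := F) (A := A)) p (1 ⊗ₜ x) (1 ⊗ₜ del F A y) =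
      LinearMap.lTensor P (del F A)
        (lamProd (LieConformalAlgebra.bracket (F := F) (A := A)) p (1 ⊗ₜ x) (1 ⊗ₜ y)) +
      p • lamProd (LieConformalAlgebra.bracket (F := F) (A := A)) p (1 ⊗ₜ x) (1 ⊗ₜ y) := by
  rw [lamProd_tmul, lamProd_tmul, LieConformalAlgebra.bracket_del_right, map_add,
    substLam_smul, Polynomial.aeval_X, smul_add, substLam_lTensor, lTensor_smul', smul_comm p]

theorem update_succAbove {n : ℕ} (a : Fin (n + 1) → A) (l : Fin (n + 1)) (m : Fin n) (v : A) :
    (fun j => Function.update a (l.succAbove m) v (l.succAbove j)) =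
      Function.update (fun j => a (l.succAbove j)) m v := by
  funext j
  by_cases h : j = m
  · subst h; simp
  · rw [Function.update_of_ne h, Function.update_of_ne]
    exact fun e => h (Fin.succAbove_right_injective e)

theorem actionPart_update {q : ℕ} {f : MultiMaps F A M q} (hf : f ∈ cochains F A M q)
    (a : Fin (q + 1) → A) (i : Fin (q + 1)) :
    actionPart f (Function.update a i (del F A (a i))) =
      -((MvPolynomial.X i : MvPolynomial (Fin (q + 1)) F) • actionPart f a) := by
  rw [actionPart_apply, actionPart_apply, Finset.smul_sum, ← Finset.sum_neg_distrib]
  refine Finset.sum_congr rfl fun k _ => ?_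
  rw [smul_comm (MvPolynomial.X i : MvPolynomial (Fin (q + 1)) F), ← zsmul_neg]
  congr 1
  rcases Fin.eq_self_or_eq_succAbove k i with h | ⟨j, h⟩
  · subst h
    simp [lamProd_act_del_left]
  · subst h
    rw [update_succAbove, cochain_del hf _ (fun j => a (k.succAbove j)) j,
      Function.update_of_ne (Fin.succAbove_ne k j).symm, map_neg, map_smul]

theorem insertFirst_update {q : ℕ} {f : MultiMaps F A M (q + 1)}
    (hf : f ∈ cochains F A M (q + 1)) (p : Fin (q + 1) → P) (x : P ⊗[F] A) (a : Fin q → A)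
    (i : Fin q) :
    insertFirst f p x (Function.update a i (del F A (a i))) =
      -(p i.succ • insertFirst f p x a) := by
  induction x with
  | zero => simp
  | tmul s y =>
    have := cochain_del hf p (Fin.cons y a) i.succ
    simp only [Fin.cons_succ, ← Fin.cons_update] at this
    rw [insertFirst_tmul, insertFirst_tmul, this, smul_neg, smul_comm]
  | add y z hy hz => simp only [map_add, add_apply, hy, hz, smul_add, neg_add]

theorem brTerm_update {q : ℕ} {f : MultiMaps F A M (q + 1)}
    (hf : f ∈ cochains F A M (q + 1)) (l : Fin (q + 2)) (k : Fin (q + 1)) (a : Fin (q + 2) → A)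
    (i : Fin (q + 2)) :
    brTerm f (l.succAbove k) l (fun j => l.succAbove (k.succAbove j))
        (Function.update a i (del F A (a i))) =
      -((MvPolynomial.X i : MvPolynomial (Fin (q + 2)) F) •
        brTerm f (l.succAbove k) l (fun j => l.succAbove (k.succAbove j)) a) := by
  rcases Fin.eq_self_or_eq_succAbove l i with h | ⟨m, h⟩
  · subst h
    simp only [brTerm, Function.update_self, Function.update_of_ne (Fin.succAbove_ne i _)]
    rw [lamProd_bracket_del_right, map_add, add_apply, insertFirst_lTensor_del hf, map_smul,
      smul_apply, Fin.cons_zero, add_smul]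
    abel
  · rcases Fin.eq_self_or_eq_succAbove k m with h' | ⟨m', h'⟩
    · subst h' h
      have e : ∀ j, Function.update a (l.succAbove m) (del F A (a (l.succAbove m)))
          (l.succAbove (m.succAbove j)) = a (l.succAbove (m.succAbove j)) := fun j =>
        Function.update_of_ne (fun e => Fin.succAbove_ne m j (Fin.succAbove_right_injective e)) _ _
      simp only [brTerm, Function.update_self, Function.update_of_ne (Fin.succAbove_ne l _).symm, e]
      rw [lamProd_bracket_del_left, map_neg, map_smul, neg_apply, smul_apply]
    · subst h' h
      have e : (fun j => Function.update a (l.succAbove (k.succAbove m'))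
          (del F A (a (l.succAbove (k.succAbove m')))) (l.succAbove (k.succAbove j))) =
          Function.update (fun j => a (l.succAbove (k.succAbove j))) m'
            (del F A (a (l.succAbove (k.succAbove m')))) := by
        rw [← update_succAbove (fun j => a (l.succAbove j)), ← update_succAbove a]
      have e' : Function.update a (l.succAbove (k.succAbove m'))
          (del F A (a (l.succAbove (k.succAbove m')))) (l.succAbove k) = a (l.succAbove k) :=
        Function.update_of_ne (fun e => Fin.succAbove_ne k m' (Fin.succAbove_right_injective e).symm) _ _
      simp only [brTerm, Function.update_of_ne (Fin.succAbove_ne l _).symm, e, e']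
      rw [insertFirst_update hf _ _ (fun j => a (l.succAbove (k.succAbove j))) m', Fin.cons_succ]

theorem two_zsmul_injective [CharZero F] {u v : P ⊗[F] M} (h : (2 : ℤ) • u = (2 : ℤ) • v) :
    u = v := by
  have h2 : ((2 : ℤ) : F) ≠ 0 := by norm_num
  rw [← Int.cast_smul_eq_zsmul F, ← Int.cast_smul_eq_zsmul F] at h
  exact smul_right_injective _ h2 h

theorem bracketPart_update [CharZero F] {q : ℕ} {f : MultiMaps F A M (q + 1)}
    (hf : f ∈ cochains F A M (q + 1)) (a : Fin (q + 2) → A) (i : Fin (q + 2)) :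
    bracketPart f (Function.update a i (del F A (a i))) =
      -((MvPolynomial.X i : MvPolynomial (Fin (q + 2)) F) • bracketPart f a) := by
  apply two_zsmul_injective
  rw [smul_neg, smul_comm, bracketPart_two hf, bracketPart_two hf, Finset.smul_sum,
    ← Finset.sum_neg_distrib]
  refine Finset.sum_congr rfl fun l _ => ?_
  rw [Finset.smul_sum, ← Finset.sum_neg_distrib]
  refine Finset.sum_congr rfl fun k _ => ?_
  rw [brTerm_update hf, smul_neg, smul_comm]

theorem differential_mem [CharZero F] {q : ℕ} {f : MultiMaps F A M q}
    (hf : f ∈ cochains F A M q) : differential F A M q f ∈ cochains F A M (q + 1) := by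
  cases q with
  | zero => exact ⟨actionPart_update hf, actionPart_perm hf⟩
  | succ q =>
    refine ⟨fun a i => ?_, fun σ a => ?_⟩
    · change actionPart f _ + bracketPart f _ = -(_ • (actionPart f a + bracketPart f a))
      rw [actionPart_update hf, bracketPart_update hf, smul_add, neg_add]
    · change substVars M _ (actionPart f _ + bracketPart f _) =
        _ • (actionPart f a + bracketPart f a)
      rw [map_add, actionPart_perm hf, bracketPart_perm hf, smul_add]

theorem insertFirst_delCochain {q : ℕ} (f : MultiMaps F A M (q + 1)) (p : Fin (q + 1) → P)
    (x : P ⊗[F] A) (a : Fin q → A) :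
    insertFirst (delCochain F A M (q + 1) f) p x a =
      LinearMap.lTensor P (del F M) (insertFirst f p x a) + (∑ i, p i) • insertFirst f p x a := by
  induction x with
  | zero => simp
  | tmul s y =>
    rw [insertFirst_tmul, insertFirst_tmul, delCochain_apply, map_add, substVars_lTensor,
      substVars_smul, map_sum, smul_add, lTensor_smul', smul_comm s]
    simp only [MvPolynomial.aeval_X]
  | add y z hy hz =>
    simp only [map_add, add_apply, hy, hz, smul_add]
    abel

theorem actionPart_delCochain {q : ℕ} (f : MultiMaps F A M q) :
    actionPart (delCochain F A M q f) = delCochain F A M (q + 1) (actionPart f) := by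
  ext a
  rw [delCochain_apply, actionPart_apply, actionPart_apply, map_sum, Finset.smul_sum,
    ← Finset.sum_add_distrib]
  refine Finset.sum_congr rfl fun k _ => ?_
  rw [delCochain_apply, map_add, substVars_lTensor, substVars_smul, map_sum, map_add,
    lamProd_act_del_right, map_smul, Fin.sum_univ_succAbove _ k, map_zsmul, smul_comm (_ + _)]
  simp only [MvPolynomial.aeval_X]
  rw [← smul_add, add_smul, add_assoc]

theorem bracketPart_delCochain {q : ℕ} (f : MultiMaps F A M (q + 1)) :
    bracketPart (delCochain F A M (q + 1) f) = delCochain F A M (q + 2) (bracketPart f) := by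
  ext a
  rw [delCochain_apply, bracketPart_apply, bracketPart_apply, map_sum, Finset.smul_sum,
    ← Finset.sum_add_distrib]
  refine Finset.sum_congr rfl fun l _ => ?_
  rw [map_sum, Finset.smul_sum, ← Finset.sum_add_distrib]
  refine Finset.sum_congr rfl fun k _ => ?_
  split_ifs with h
  · rw [insertFirst_delCochain, map_zsmul, smul_comm (∑ k : Fin (q + 2), _), ← smul_add]
    congr 3
    rw [Fin.sum_univ_succ, Fin.sum_univ_succAbove _ l, Fin.sum_univ_succAbove _ k,
      Fin.succAbove_of_castSucc_lt _ _ h]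
    simp only [Fin.cons_zero, Fin.cons_succ]
    ring
  · simp

theorem differential_delCochain {q : ℕ} (f : MultiMaps F A M q) :
    differential F A M q (delCochain F A M q f) =
      delCochain F A M (q + 1) (differential F A M q f) := by
  cases q with
  | zero => exact actionPart_delCochain f
  | succ q =>
    change actionPart _ + bracketPart _ = delCochain F A M _ (actionPart f + bracketPart f)
    rw [actionPart_delCochain, bracketPart_delCochain, map_add]

end Preserve

section Cohomology

variable (F : Type u) (A : Type v) (M : Type w) [Field F] [CharZero F]
variable [AddCommGroup A] [Module F A] [Module F[X] A] [IsScalarTower F F[X] A]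
variable [AddCommGroup M] [Module F M] [Module F[X] M] [IsScalarTower F F[X] M]

/-- The additive group structure on `C̃^q(A, M)`, declared again to help instance search. -/
instance cochains_addCommGroup (q : ℕ) : AddCommGroup (cochains F A M q) :=
  inferInstance

/-- The operator `∂` on the space `C̃^q(A, M)` of `q`-cochains. -/
def delC (q : ℕ) : cochains F A M q →ₗ[F] cochains F A M q :=
  (delCochain F A M q).restrict fun _ hf => delCochain_mem hf

/-- The space `C^q(A, M) = C̃^q / ∂ C̃^q` of reduced `q`-cochains. -/
abbrev ReducedCochains (q : ℕ) : Type (max u v w) :=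
  cochains F A M q ⧸ LinearMap.range (delC F A M q)

variable [LieConformalAlgebra F A] [LCModule F A M]

/-- The differential `d : C̃^q → C̃^{q+1}` of the basic complex. -/
def dC (q : ℕ) : cochains F A M q →ₗ[F] cochains F A M (q + 1) :=
  (differential F A M q).restrict fun _ hf => differential_mem hf

theorem dC_delC (q : ℕ) (f : cochains F A M q) :
    dC F A M q (delC F A M q f) = delC F A M (q + 1) (dC F A M q f) :=
  Subtype.ext (differential_delCochain (f : MultiMaps F A M q))

/-- The differential `C^q → C^{q+1}` of the reduced complex, induced by `d`. -/
def dRed (q : ℕ) : ReducedCochains F A M q →ₗ[F] ReducedCochains F A M (q + 1) :=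
  Submodule.mapQ _ _ (dC F A M q) (by
    rintro _ ⟨g, rfl⟩
    exact ⟨dC F A M q g, (dC_delC F A M q g).symm⟩)

/-- The space of `q`-cocycles of the basic complex. -/
def basicCocycles (q : ℕ) : Submodule F (cochains F A M q) :=
  LinearMap.ker (dC F A M q)

/-- The space of `q`-coboundaries of the basic complex, zero for `q = 0`. -/
def basicCoboundaries : (q : ℕ) → Submodule F (cochains F A M q)
  | 0 => ⊥
  | q + 1 => LinearMap.range (dC F A M q)

/-- The basic cohomology `H̃^q(A, M)`: cocycles modulo coboundaries. -/
abbrev BasicCohomology (q : ℕ) : Type (max u v w) :=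
  basicCocycles F A M q ⧸ (basicCoboundaries F A M q).submoduleOf (basicCocycles F A M q)

/-- The space of `q`-cocycles of the reduced complex. -/
def reducedCocycles (q : ℕ) : Submodule F (ReducedCochains F A M q) :=
  LinearMap.ker (dRed F A M q)

/-- The space of `q`-coboundaries of the reduced complex, zero for `q = 0`. -/
def reducedCoboundaries : (q : ℕ) → Submodule F (ReducedCochains F A M q)
  | 0 => ⊥
  | q + 1 => LinearMap.range (dRed F A M q)

/-- The (reduced) cohomology `H^q(A, M)`, the cohomology of the reduced complex. -/
abbrev ReducedCohomology (q : ℕ) : Type (max u v w) :=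
  reducedCocycles F A M q ⧸ (reducedCoboundaries F A M q).submoduleOf (reducedCocycles F A M q)

variable {F A M}

/-- The class `[f] ∈ H̃^q(A, M)` of a cocycle `f`. -/
def basicClass {q : ℕ} (f : basicCocycles F A M q) : BasicCohomology F A M q :=
  Submodule.Quotient.mk f

/-- The projection `f̄ ∈ C^q(A, M)` of a cochain `f ∈ C̃^q(A, M)`. -/
def proj {q : ℕ} (f : cochains F A M q) : ReducedCochains F A M q :=
  Submodule.Quotient.mk f

/-- `x ∈ H^q(A, M)` is the class `[f̄]` of the cochain `f`, that is, `f̄` is a cocycle of the reduced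
complex and `x` is its class. -/
def IsReducedClass {q : ℕ} (x : ReducedCohomology F A M q) (f : cochains F A M q) : Prop :=
  ∃ h : proj f ∈ reducedCocycles F A M q, x = Submodule.Quotient.mk ⟨proj f, h⟩

end Cohomology

section Tau

variable {F : Type u} {A : Type v} {M : Type w} [Field F]
variable [AddCommGroup A] [Module F A]
variable [AddCommGroup M] [Module F M]

/-- The map `M[λ₁, …, λ_q, λ] → M[λ₁, …, λ_q]`, `z ↦ (d/dλ) z |_{λ = 0}`. -/
def derivLast (F : Type u) (M : Type w) [Field F] [AddCommGroup M] [Module F M] (q : ℕ) :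
    MvPolynomial (Fin (q + 1)) F ⊗[F] M →ₗ[F] MvPolynomial (Fin q) F ⊗[F] M :=
  LinearMap.rTensor M
    ((MvPolynomial.aeval (Fin.snoc (fun i => MvPolynomial.X i) 0 :
        Fin (q + 1) → MvPolynomial (Fin q) F)).toLinearMap ∘ₗ
      (MvPolynomial.pderiv (R := F) (Fin.last q)).toLinearMap)

/-- `(τf)_{λ₁, …, λ_q}(a₁, …, a_q) = (-1)^q (d/dλ) f_{λ₁, …, λ_q, λ}(a₁, …, a_q, L) |_{λ = 0}` for a
`(q + 1)`-cochain `f`. -/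
def tauMulti (L : A) (q : ℕ) : MultiMaps F A M (q + 1) →ₗ[F] MultiMaps F A M q where
  toFun f := (-1 : ℤ) ^ q • (derivLast F M q ∘ₗ LinearMap.applyₗ L).compMultilinearMap f.curryRight
  map_add' f g := by
    ext a
    change (-1 : ℤ) ^ q • derivLast F M q (f (Fin.snoc a L) + g (Fin.snoc a L)) =
      (-1 : ℤ) ^ q • derivLast F M q (f (Fin.snoc a L)) +
        (-1 : ℤ) ^ q • derivLast F M q (g (Fin.snoc a L))
    rw [map_add, smul_add]
  map_smul' c f := by
    ext a
    change (-1 : ℤ) ^ q • derivLast F M q (c • f (Fin.snoc a L)) =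
      c • (-1 : ℤ) ^ q • derivLast F M q (f (Fin.snoc a L))
    rw [map_smul, smul_comm]

theorem tauMulti_apply (L : A) {q : ℕ} (f : MultiMaps F A M (q + 1)) (a : Fin q → A) :
    tauMulti L q f a = (-1 : ℤ) ^ q • derivLast F M q (f (Fin.snoc a L)) := rfl

theorem derivLast_smul {q : ℕ} (i : Fin q) (z : MvPolynomial (Fin (q + 1)) F ⊗[F] M) :
    derivLast F M q ((MvPolynomial.X i.castSucc : MvPolynomial (Fin (q + 1)) F) • z) =
      (MvPolynomial.X i : MvPolynomial (Fin q) F) • derivLast F M q z := by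
  induction z with
  | zero => simp
  | tmul s y =>
    simp [derivLast, TensorProduct.smul_tmul', Derivation.leibniz, MvPolynomial.pderiv_X]
  | add y z hy hz => simp only [map_add, smul_add, hy, hz]

theorem derivLast_rename {q : ℕ} (σ : Equiv.Perm (Fin q)) (σ' : Equiv.Perm (Fin (q + 1)))
    (h : ∀ i, σ' i.castSucc = (σ i).castSucc) (hl : σ' (Fin.last q) = Fin.last q)
    (z : MvPolynomial (Fin (q + 1)) F ⊗[F] M) :
    substVars M (fun i => (MvPolynomial.X (σ i) : MvPolynomial (Fin q) F)) (derivLast F M q z) =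
      derivLast F M q
        (substVars M (fun i => (MvPolynomial.X (σ' i) : MvPolynomial (Fin (q + 1)) F)) z) := by
  induction z with
  | zero => simp
  | tmul s y =>
    simp only [derivLast, substVars, LinearMap.rTensor_tmul, LinearMap.comp_apply,
      AlgHom.toLinearMap_apply, Derivation.coeFn_coe]
    congr 1
    have e : (MvPolynomial.aeval (fun i => (MvPolynomial.X (σ' i) :
        MvPolynomial (Fin (q + 1)) F)) s) = MvPolynomial.rename σ' s := by
      rw [MvPolynomial.rename_eq_aeval]; rfl
    rw [e]
    have e2 := MvPolynomial.pderiv_rename σ'.injective (Fin.last q) s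
    rw [hl] at e2
    rw [e2, MvPolynomial.aeval_rename]
    rw [MvPolynomial.comp_aeval_apply]
    congr 2
    ext i : 1
    refine Fin.lastCases ?_ (fun j => ?_) i <;> simp [h, hl]
  | add y z hy hz => simp only [map_add, hy, hz]

theorem exists_perm_castSucc {q : ℕ} (σ : Equiv.Perm (Fin q)) :
    ∃ σ' : Equiv.Perm (Fin (q + 1)), (∀ i, σ' i.castSucc = (σ i).castSucc) ∧
      σ' (Fin.last q) = Fin.last q ∧ Equiv.Perm.sign σ' = Equiv.Perm.sign σ := by
  refine ⟨finSuccEquivLast.symm.permCongr (Equiv.optionCongr σ), fun i => ?_, ?_, ?_⟩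
  · simp [Equiv.permCongr_apply]
  · simp [Equiv.permCongr_apply]
  · rw [Equiv.Perm.sign_permCongr, Equiv.optionCongr_sign]

variable [Module F[X] A] [IsScalarTower F F[X] A]

theorem tauMulti_mem (L : A) {q : ℕ} {f : MultiMaps F A M (q + 1)}
    (hf : f ∈ cochains F A M (q + 1)) : tauMulti L q f ∈ cochains F A M q := by
  refine ⟨fun a i => ?_, fun σ a => ?_⟩
  · have := hf.1 (Fin.snoc a L) i.castSucc
    rw [Fin.snoc_castSucc, ← Fin.snoc_update] at this
    rw [tauMulti_apply, tauMulti_apply, this, map_neg, derivLast_smul, smul_comm, smul_neg]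
  · obtain ⟨σ', h, hl, hs⟩ := exists_perm_castSucc σ
    have := hf.2 σ' (Fin.snoc a L)
    have e : (Fin.snoc a L : Fin (q + 1) → A) ∘ σ' = Fin.snoc (a ∘ σ) L := by
      funext i
      refine Fin.lastCases ?_ (fun j => ?_) i <;> simp [h, hl]
    rw [e, hs] at this
    rw [tauMulti_apply, tauMulti_apply, map_zsmul, derivLast_rename σ σ' h hl, this, map_zsmul,
      smul_comm]

/-- The operator `τ : C̃^{q+1} → C̃^q` attached to `L`. -/
def tau (M : Type w) [AddCommGroup M] [Module F M] (L : A) (q : ℕ) :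
    cochains F A M (q + 1) →ₗ[F] cochains F A M q :=
  (tauMulti L q).restrict fun _ hf => tauMulti_mem L hf

end Tau

end LieConformal

end

open LieConformal

open scoped TensorProduct Polynomial

set_option linter.unusedSectionVars false

noncomputable section

namespace LieConformal

universe u v w

/-! Write `ι` for the contraction `f ↦ f_{0, λ₁, …}(L, …)`. Everything rests on four facts. (a) `d²
= 0` (`dC_dC`). (b) `∂ = dι + ιd` in positive degrees (`delC_eq`): `∂` is the Lie derivative along
`L` at `λ = 0`, because `L_(0)` is `∂` on both `A` and `M`, so this is Cartan's formula. (c) `∂` is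
injective on cochains of positive degree (`delC_injective`), since it contains multiplication by `λ₁
+ … + λ_q`. (d) `ι = τ∂ - ∂τ` (`tauMulti_delCochain`, `contractZero`), so `ι` preserves cochains,
and `ι g` and `τ(∂g)` have the same image in the quotient by `∂`.

By (b), a basic cocycle `g` satisfies `d(ιg) = ∂g`, so `ιg` is a reduced cocycle, and `(f, g) ↦ f +
ιg` induces a map from the product of the two basic cohomologies to the reduced one. If `f + ιg = dh
+ ∂k`, then applying `d` gives `∂g = ∂dk`, hence `g = dk` by (c), and then (b) for `k` gives `f =
d(h + ιk)`. If `df = ∂g`, then `∂dg = ddf = 0`, so `g` is a cocycle, and so is `f - ιg`. Thus the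
map is bijective (`splittingEquiv`), and by (d) it carries the given pair of bases to the claimed
one.

Facts (a) and (b) come from a formal calculus with no polynomials in it. For a commutative
`F`-algebra `P`, a pair `(p, x)` in `P × (P ⊗ A)` stands for the element `x` together with the value
`p` of its parameter; the bracket is `(p + r, [x_p y])`, and `(p, x)` acts on `P ⊗ M` by `x_p`. A
cochain becomes a function of such pairs (`cochainExt`), and `d` becomes the Chevalley–Eilenberg
differential. On skew-symmetric functions this is the Leibniz differential (`ceD_eq_leibD`), which
is defined so that Cartan's formula holds by construction. Taking `P` to be the polynomial ring and
the parameters to be its variables recovers the original cochain. -/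

/-! ### Leibniz cochains of a magma acting on a module -/

section Leibniz

variable {R : Type*} [CommRing R] {G : Type*} {N : Type*} [AddCommGroup N] [Module R N]
variable (br : G → G → G) (act : G → N →ₗ[R] N)

/-- Insertion of `x` as the first argument. -/
def contract (R : Type*) [CommRing R] [Module R N] {q : ℕ} (x : G) :
    ((Fin (q + 1) → G) → N) →ₗ[R] ((Fin q → G) → N) where
  toFun φ y := φ (Fin.cons x y)
  map_add' _ _ := rfl
  map_smul' _ _ := rfl

@[simp]
theorem contract_apply {q : ℕ} (x : G) (φ : (Fin (q + 1) → G) → N) (y : Fin q → G) :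
    contract R x φ y = φ (Fin.cons x y) := rfl

/-- The Lie derivative along `x`. -/
def lieDer {q : ℕ} (x : G) : ((Fin q → G) → N) →ₗ[R] ((Fin q → G) → N) where
  toFun φ y := act x (φ y) - ∑ i, φ (Function.update y i (br x (y i)))
  map_add' φ ψ := by
    funext y
    simp only [Pi.add_apply, map_add, Finset.sum_add_distrib]
    abel
  map_smul' c φ := by
    funext y
    simp only [Pi.smul_apply, map_smul, smul_sub, Finset.smul_sum, RingHom.id_apply]

theorem lieDer_apply {q : ℕ} (x : G) (φ : (Fin q → G) → N) (y : Fin q → G) :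
    lieDer br act x φ y = act x (φ y) - ∑ i, φ (Function.update y i (br x (y i))) := rfl

/-- The Leibniz differential, defined by Cartan's formula. -/
def leibD : (q : ℕ) → ((Fin q → G) → N) →ₗ[R] ((Fin (q + 1) → G) → N)
  | 0 =>
    { toFun := fun φ y => act (y 0) (φ (Fin.tail y))
      map_add' := fun φ ψ => by
        funext y
        simp
      map_smul' := fun c φ => by
        funext y
        simp }
  | q + 1 =>
    { toFun := fun φ y => lieDer br act (y 0) φ (Fin.tail y) -
        leibD q (contract R (y 0) φ) (Fin.tail y)
      map_add' := fun φ ψ => by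
        funext y
        simp only [map_add, Pi.add_apply]
        abel
      map_smul' := fun c φ => by
        funext y
        simp only [map_smul, Pi.smul_apply, smul_sub, RingHom.id_apply] }

/-- This makes induction on the degree possible: identities between operators are checked after
contraction, where the three commutation rules below apply. -/
theorem contract_ext {q : ℕ} {φ ψ : (Fin (q + 1) → G) → N}
    (h : ∀ x, contract R x φ = contract R x ψ) : φ = ψ := by
  funext y
  have := congrFun (h (y 0)) (Fin.tail y)
  simpa using this

theorem contract_leibD_zero (x : G) (φ : (Fin 0 → G) → N) :
    contract R x (leibD br act 0 φ) = lieDer br act x φ := by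
  funext y
  simp [leibD, lieDer_apply]

theorem contract_leibD_succ {q : ℕ} (x : G) (φ : (Fin (q + 1) → G) → N) :
    contract R x (leibD br act (q + 1) φ) =
      lieDer br act x φ - leibD br act q (contract R x φ) := by
  funext y
  simp [leibD]

/-- The summand of the Lie derivative that brackets `x` into the first slot is the correction term;
all the others belong to the contracted cochain. -/
theorem contract_lieDer {q : ℕ} (x z : G) (φ : (Fin (q + 1) → G) → N) :
    contract R z (lieDer br act x φ) =
      lieDer br act x (contract R z φ) - contract R (br x z) φ := by
  funext y
  simp only [contract_apply, lieDer_apply, Pi.sub_apply, Fin.sum_univ_succ, Fin.cons_zero,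
    Fin.cons_succ, Fin.update_cons_zero, Fin.cons_update]
  abel

/-- A cochain respects the left Leibniz identity of the bracket in each argument. -/
def IsLeibniz {q : ℕ} (φ : (Fin q → G) → N) : Prop :=
  ∀ y i x z w, φ (Function.update y i (br x (br z w))) =
    φ (Function.update y i (br (br x z) w)) + φ (Function.update y i (br z (br x w)))

variable {br act}

theorem IsLeibniz.contract {q : ℕ} {φ : (Fin (q + 1) → G) → N} (h : IsLeibniz br φ) (x : G) :
    IsLeibniz br (contract R x φ) := by
  intro y i u z w
  simp only [contract_apply, Fin.cons_update]
  exact h _ _ _ _ _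

theorem IsLeibniz.contract_br {q : ℕ} {φ : (Fin (q + 1) → G) → N} (h : IsLeibniz br φ)
    (x z w : G) :
    LieConformal.contract R (br x (br z w)) φ =
      LieConformal.contract R (br (br x z) w) φ + LieConformal.contract R (br z (br x w)) φ := by
  funext y
  have := h (Fin.cons x y) 0 x z w
  simp only [Fin.update_cons_zero] at this
  exact this

/-- In degree 0 this is the module axiom. Contracting with `z` leaves, besides the induction
hypothesis, contractions with double brackets of `x`, `y`, `z`, and these match by the Leibniz
identity. That identity is assumed of `φ` and not of `br`, because `G` carries no addition in which
it could be written. -/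
theorem lieDer_comm (hact : ∀ x y n, act x (act y n) - act y (act x n) = act (br x y) n)
    {q : ℕ} {φ : (Fin q → G) → N} (h : IsLeibniz br φ) (x y : G) :
    lieDer br act x (lieDer br act y φ) =
      lieDer br act y (lieDer br act x φ) + lieDer br act (br x y) φ := by
  induction q with
  | zero =>
    funext z
    simp [lieDer_apply, ← hact]
  | succ q ih =>
    refine contract_ext (R := R) fun z => ?_
    simp only [map_add, contract_lieDer, map_sub, ih (h.contract z)]
    rw [h.contract_br (R := R) x y z]
    abel

/-- With `ι_y d = L_y - d ι_y` and `ι_y L_x = L_x ι_y - ι_{[x,y]}`, the contraction of both sides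
with `y` reduces to the commutator of Lie derivatives and to the case of one degree lower. -/
theorem lieDer_leibD (hact : ∀ x y n, act x (act y n) - act y (act x n) = act (br x y) n)
    {q : ℕ} {φ : (Fin q → G) → N} (h : IsLeibniz br φ) (x : G) :
    lieDer br act x (leibD br act q φ) = leibD br act q (lieDer br act x φ) := by
  induction q with
  | zero =>
    refine contract_ext (R := R) fun y => ?_
    rw [contract_lieDer, contract_leibD_zero, contract_leibD_zero, contract_leibD_zero,
      lieDer_comm hact h]
    abel
  | succ q ih =>
    refine contract_ext (R := R) fun y => ?_
    simp only [contract_lieDer, contract_leibD_succ, map_sub]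
    rw [ih (h.contract y), lieDer_comm hact h]
    abel

/-- Two uses of Cartan's formula give `ι_x d d = L_x d - d L_x + d d ι_x`; the first two terms
cancel and the last vanishes by induction. -/
theorem leibD_leibD (hact : ∀ x y n, act x (act y n) - act y (act x n) = act (br x y) n)
    {q : ℕ} {φ : (Fin q → G) → N} (h : IsLeibniz br φ) :
    leibD br act (q + 1) (leibD br act q φ) = 0 := by
  induction q with
  | zero =>
    refine contract_ext (R := R) fun x => ?_
    rw [contract_leibD_succ, contract_leibD_zero, lieDer_leibD hact h, sub_self, map_zero]
  | succ q ih =>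
    refine contract_ext (R := R) fun x => ?_
    rw [contract_leibD_succ, contract_leibD_succ, map_sub, lieDer_leibD hact h,
      ih (h.contract x)]
    simp

/-! ### The Chevalley–Eilenberg formula -/

/-- A cochain is skew-symmetric. -/
def IsAlt {q : ℕ} (φ : (Fin q → G) → N) : Prop :=
  ∀ (σ : Equiv.Perm (Fin q)) (y : Fin q → G),
    φ (y ∘ σ) = ((Equiv.Perm.sign σ : ℤˣ) : ℤ) • φ y

theorem IsAlt.contract {q : ℕ} {φ : (Fin (q + 1) → G) → N} (h : IsAlt φ) (x : G) :
    IsAlt (contract R x φ) := by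
  intro σ y
  have := h (Equiv.Perm.decomposeFin.symm (0, σ)) (Fin.cons x y)
  rw [Equiv.Perm.decomposeFin.symm_sign, if_pos rfl, one_mul] at this
  rw [contract_apply, contract_apply, ← this]
  congr 1
  funext i
  refine Fin.cases ?_ (fun j => ?_) i <;> simp

/-- Moving the first argument to position `l` is a cycle of sign `(-1) ^ l`. -/
theorem IsAlt.cons_succAbove {q : ℕ} {φ : (Fin (q + 1) → G) → N} (h : IsAlt φ)
    (y : Fin (q + 1) → G) (l : Fin (q + 1)) (z : G) :
    φ (Fin.cons z fun j => y (l.succAbove j)) =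
      (-1 : ℤ) ^ (l : ℕ) • φ (Function.update y l z) := by
  have := h l.cycleRange.symm (Function.update y l z)
  rw [Equiv.Perm.sign_symm, Fin.sign_cycleRange] at this
  push_cast at this
  rw [← this]
  congr 1
  funext i
  refine Fin.cases ?_ (fun j => ?_) i <;> simp

theorem IsAlt.swap {q : ℕ} {φ : (Fin (q + 2) → G) → N} (h : IsAlt φ) (u v : G)
    (y : Fin q → G) :
    φ (Fin.cons u (Fin.cons v y : Fin (q + 1) → G)) =
      -φ (Fin.cons v (Fin.cons u y : Fin (q + 1) → G)) := by
  have := h (Equiv.swap 0 1) (Fin.cons v (Fin.cons u y : Fin (q + 1) → G))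
  rw [Equiv.Perm.sign_swap (by simp)] at this
  simp only [Units.val_neg, Units.val_one, neg_smul, one_smul] at this
  rw [← this]
  congr 1
  funext i
  refine Fin.cases ?_ (fun j => Fin.cases ?_ (fun m => ?_) j) i
  · simp
  · simp
  · rw [Function.comp_apply, Equiv.swap_apply_of_ne_of_ne (Fin.succ_ne_zero _)]
    · simp
    · exact fun e => Fin.succ_ne_zero m (Fin.succ_injective _ e)

variable (act) in
/-- The action part of the Chevalley–Eilenberg differential. -/
def ceAction {q : ℕ} (φ : (Fin q → G) → N) : (Fin (q + 1) → G) → N := fun y =>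
  ∑ k : Fin (q + 1), (-1 : ℤ) ^ (k : ℕ) • act (y k) (φ fun j => y (k.succAbove j))

variable (br) in
/-- The bracket part of the Chevalley–Eilenberg differential. -/
def ceBracket {q : ℕ} (φ : (Fin (q + 1) → G) → N) : (Fin (q + 2) → G) → N := fun y =>
  ∑ l : Fin (q + 2), ∑ k : Fin (q + 1), if k.castSucc < l then
    (-1 : ℤ) ^ ((k : ℕ) + (l : ℕ)) •
      φ (Fin.cons (br (y k.castSucc) (y l)) fun j => y (l.succAbove (k.succAbove j)))
  else 0

theorem ceAction_zero (φ : (Fin 0 → G) → N) : ceAction act φ = leibD br act 0 φ := by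
  funext y
  simp only [ceAction, leibD, Fin.sum_univ_succ, Finset.univ_eq_empty, Finset.sum_empty, add_zero,
    Fin.val_zero, pow_zero, one_smul]
  rfl

theorem cons_succ_succAbove {q : ℕ} (x : G) (y : Fin (q + 1) → G) (k : Fin (q + 1)) :
    (fun j => (Fin.cons x y : Fin (q + 2) → G) (k.succ.succAbove j)) =
      Fin.cons x fun j => y (k.succAbove j) := by
  funext j
  refine Fin.cases ?_ (fun m => ?_) j <;> simp

theorem contract_ceAction {q : ℕ} (x : G) (φ : (Fin (q + 1) → G) → N) (y : Fin (q + 1) → G) :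
    ceAction act φ (Fin.cons x y) = act x (φ y) - ceAction act (contract R x φ) y := by
  simp only [ceAction]
  rw [Fin.sum_univ_succ, sub_eq_add_neg, ← Finset.sum_neg_distrib]
  congr 1
  · simp
  · refine Finset.sum_congr rfl fun k _ => ?_
    rw [cons_succ_succAbove, Fin.cons_succ, contract_apply, Fin.val_succ, pow_succ, mul_neg_one,
      neg_smul]

/-- The pairs `k < l` are split by whether `k = 0`. Those with `k = 0` bracket `x` with some `y l`;
moving the result back to slot `l` turns the sign `(-1) ^ (l + 1)` into `-1` and yields the sum in
the Lie derivative. In the others `x` survives as an argument, and shifting both indices by one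
leaves the sign unchanged. -/
theorem contract_ceBracket_aux {q : ℕ} {φ : (Fin (q + 1) → G) → N} (h : IsAlt φ) (x : G)
    (y : Fin (q + 1) → G) :
    ceBracket br φ (Fin.cons x y) = -(∑ i, φ (Function.update y i (br x (y i)))) +
      ∑ l : Fin (q + 1), ∑ k : Fin q, if k.castSucc < l then
        (-1 : ℤ) ^ ((k : ℕ) + (l : ℕ)) • φ (Fin.cons (br (y k.castSucc) (y l)) fun j =>
          (Fin.cons x y : Fin (q + 2) → G) (l.succ.succAbove (k.succ.succAbove j))) else 0 := by
  simp only [ceBracket]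
  rw [Fin.sum_univ_succ]
  simp only [Fin.not_lt_zero, if_false, Finset.sum_const_zero, zero_add]
  rw [← Finset.sum_neg_distrib, ← Finset.sum_add_distrib]
  refine Finset.sum_congr rfl fun l _ => ?_
  rw [Fin.sum_univ_succ]
  congr 1
  · have e : (fun j => (Fin.cons x y : Fin (q + 2) → G)
        (l.succ.succAbove ((0 : Fin (q + 1)).succAbove j))) = fun j => y (l.succAbove j) := by
      funext j
      simp
    rw [e, if_pos (by simp), Fin.castSucc_zero, Fin.cons_zero, Fin.cons_succ, h.cons_succAbove,
      smul_smul, Fin.val_zero, Fin.val_succ, zero_add, pow_succ, mul_assoc, neg_one_mul, mul_neg,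
      ← mul_pow]
    simp
  · refine Finset.sum_congr rfl fun k _ => ?_
    have e : k.succ.castSucc = k.castSucc.succ := rfl
    simp only [e, Fin.succ_lt_succ_iff, Fin.cons_succ]
    congr 2
    simp only [Fin.val_succ]
    ring

/-- By induction it suffices that the Chevalley–Eilenberg differential satisfies the recursion that
defines the Leibniz one. The action part and the bracket part each split into a piece of the Lie
derivative and minus the same part for the contracted cochain. -/
theorem ceD_eq_leibD {q : ℕ} {φ : (Fin (q + 1) → G) → N} (h : IsAlt φ) :
    ceAction act φ + ceBracket br φ = leibD br act (q + 1) φ := by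
  induction q with
  | zero =>
    refine contract_ext (R := R) fun x => ?_
    rw [contract_leibD_succ, ← ceAction_zero]
    funext y
    rw [contract_apply, Pi.add_apply, contract_ceAction (R := R), contract_ceBracket_aux h,
      Pi.sub_apply, lieDer_apply]
    simp only [Finset.univ_eq_empty (α := Fin 0), Finset.sum_empty, Finset.sum_const_zero]
    abel
  | succ q ih =>
    refine contract_ext (R := R) fun x => ?_
    rw [contract_leibD_succ, ← ih (h.contract x)]
    funext y
    rw [contract_apply, Pi.add_apply, contract_ceAction (R := R), contract_ceBracket_aux h,
      Pi.sub_apply, lieDer_apply, Pi.add_apply, ceBracket]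
    -- In the remaining summands `x` stands second, behind the bracket; exchanging these two
    -- arguments produces the minus sign in front of `d ι_x`.
    have e : ∀ (l : Fin (q + 2)) (k : Fin (q + 1)),
        φ (Fin.cons (br (y k.castSucc) (y l)) fun j =>
          (Fin.cons x y : Fin (q + 3) → G) (l.succ.succAbove (k.succ.succAbove j))) =
        -(contract R x φ (Fin.cons (br (y k.castSucc) (y l)) fun j =>
          y (l.succAbove (k.succAbove j)))) := by
      intro l k
      rw [contract_apply, h.swap, neg_neg]
      congr 2
      funext j
      refine Fin.cases ?_ (fun m => ?_) j <;> simp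
    have e' : ∀ (p : Prop) [Decidable p] (n : N),
        (if p then -n else 0) = -(if p then n else 0) := by
      intro p _ n
      split_ifs <;> simp
    simp only [e, smul_neg, e', Finset.sum_neg_distrib]
    abel

end Leibniz

/-! ### Graded multilinear cochains -/

section GradedLinear

variable {P : Type*} [CommRing P] {V : Type*} [AddCommGroup V] [Module P V]
variable {N : Type*} [AddCommGroup N] [Module P N]

variable (P) in
/-- A function of `q` arguments in `P × V` which, with the first components fixed, is `P`-linear in
each of the second components. -/
def IsGradedLinear {q : ℕ} (φ : (Fin q → P × V) → N) : Prop :=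
  ∀ y i s, IsLinearMap P fun u => φ (Function.update y i (s, u))

theorem IsGradedLinear.contract {q : ℕ} {φ : (Fin (q + 1) → P × V) → N}
    (h : IsGradedLinear P φ) (x : P × V) : IsGradedLinear P (contract P x φ) := by
  intro y i s
  simp only [contract_apply, Fin.cons_update]
  exact h _ _ _

theorem IsGradedLinear.cons {q : ℕ} {φ : (Fin (q + 1) → P × V) → N}
    (h : IsGradedLinear P φ) (s : P) (y : Fin q → P × V) :
    IsLinearMap P fun u => φ (Fin.cons (s, u) y) := by
  have := h (Fin.cons (s, 0) y) 0 s
  simpa only [Fin.update_cons_zero] using this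

/-- The multilinear map obtained from a graded multilinear function by fixing the first
components. -/
def IsGradedLinear.toMultilinearMap {q : ℕ} {φ : (Fin q → P × V) → N}
    (h : IsGradedLinear P φ) (p : Fin q → P) : MultilinearMap P (fun _ : Fin q => V) N where
  toFun x := φ fun i => (p i, x i)
  map_update_add' {inst} x i u v := by
    -- The field quantifies over all decidability instances; this fixes the one that
    -- `IsGradedLinear` uses in `Function.update`.
    obtain rfl := Subsingleton.elim inst (instDecidableEqFin q)
    have e : ∀ u, (fun j => (p j, Function.update x i u j)) =
        Function.update (fun j => (p j, x j)) i (p i, u) := by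
      intro u
      funext j
      by_cases hj : j = i
      · subst hj; simp
      · simp [hj]
    simp only [e]
    exact (h _ _ _).map_add u v
  map_update_smul' {inst} x i c u := by
    obtain rfl := Subsingleton.elim inst (instDecidableEqFin q)
    have e : ∀ u, (fun j => (p j, Function.update x i u j)) =
        Function.update (fun j => (p j, x j)) i (p i, u) := by
      intro u
      funext j
      by_cases hj : j = i
      · subst hj; simp
      · simp [hj]
    simp only [e]
    exact (h _ _ _).map_smul c u

variable (br : P → V →ₗ[P] V →ₗ[P] V) (act : P → V →ₗ[P] N →ₗ[P] N)

/-- The bracket on `P × V` attached to a family of brackets on `V`. -/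
def gradedBr (x y : P × V) : P × V := (x.1 + y.1, br x.1 x.2 y.2)

/-- The action of `P × V` attached to a family of actions of `V`. -/
def gradedAct (x : P × V) : N →ₗ[P] N := act x.1 x.2

variable {br act}

theorem IsGradedLinear.lieDer {q : ℕ} {φ : (Fin q → P × V) → N} (h : IsGradedLinear P φ)
    (x : P × V) : IsGradedLinear P (lieDer (gradedBr br) (gradedAct act) x φ) := by
  intro y i s
  -- If the bracket hits slot `i` itself, the first component there becomes `x.1 + s`, which does
  -- not depend on `u`, so linearity of `φ` composes with that of the bracket. Otherwise the two
  -- updates commute.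
  have key : ∀ j, IsLinearMap P fun u => φ (Function.update (Function.update y i (s, u)) j
      (gradedBr br x (Function.update y i (s, u) j))) := by
    intro j
    by_cases hj : j = i
    · subst hj
      simp only [Function.update_idem, Function.update_self, gradedBr]
      exact (h y j (x.1 + s)).mk' _ ∘ₗ br x.1 x.2 |>.isLinear
    · simp only [Function.update_of_ne hj]
      have e : ∀ u, Function.update (Function.update y i (s, u)) j (gradedBr br x (y j)) =
          Function.update (Function.update y j (gradedBr br x (y j))) i (s, u) := fun u =>
        Function.update_comm (Ne.symm hj) _ _ _
      simp only [e]
      exact h _ i s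
  refine ⟨fun u v => ?_, fun c u => ?_⟩
  · simp only [lieDer_apply, (h y i s).map_add, (key _).map_add, map_add, Finset.sum_add_distrib]
    abel
  · simp only [lieDer_apply, (h y i s).map_smul, (key _).map_smul, map_smul, smul_sub,
      Finset.smul_sum]

theorem IsGradedLinear.lieDer_left {q : ℕ} {φ : (Fin q → P × V) → N} (h : IsGradedLinear P φ)
    (s : P) : IsLinearMap P fun u => LieConformal.lieDer (gradedBr br) (gradedAct act) (s, u) φ := by
  have key : ∀ y i, IsLinearMap P fun u => φ (Function.update y i (gradedBr br (s, u) (y i))) :=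
    fun y i => (h y i (s + (y i).1)).mk' _ ∘ₗ (br s).flip (y i).2 |>.isLinear
  refine ⟨fun u v => ?_, fun c u => ?_⟩
  · funext y
    simp only [lieDer_apply, Pi.add_apply, (key y _).map_add, gradedAct, map_add,
      LinearMap.add_apply, Finset.sum_add_distrib]
    abel
  · funext y
    simp only [lieDer_apply, Pi.smul_apply, (key y _).map_smul, gradedAct, map_smul,
      LinearMap.smul_apply, smul_sub, Finset.smul_sum]

theorem IsGradedLinear.contract_left {q : ℕ} {φ : (Fin (q + 1) → P × V) → N}
    (h : IsGradedLinear P φ) (s : P) :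
    IsLinearMap P fun u => LieConformal.contract P (s, u) φ :=
  ⟨fun u v => funext fun y => (h.cons s y).map_add u v,
    fun c u => funext fun y => (h.cons s y).map_smul c u⟩

/-- This separates the first slot from the rest, as suits the Leibniz differential, which is known
only through its contractions. -/
theorem isGradedLinear_of_contract {q : ℕ} {φ : (Fin (q + 1) → P × V) → N}
    (h : ∀ x, IsGradedLinear P (contract P x φ))
    (h' : ∀ s, IsLinearMap P fun u => contract P (s, u) φ) : IsGradedLinear P φ := by
  intro y i s
  obtain ⟨x, z, rfl⟩ : ∃ x z, y = Fin.cons x z := ⟨y 0, Fin.tail y, (Fin.cons_self_tail y).symm⟩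
  refine Fin.cases ?_ (fun j => ?_) i
  · simp only [Fin.update_cons_zero]
    exact ⟨fun u v => congrFun ((h' s).map_add u v) z, fun c u => congrFun ((h' s).map_smul c u) z⟩
  · simp only [← Fin.cons_update]
    exact h x z j s

theorem IsGradedLinear.leibD {q : ℕ} {φ : (Fin q → P × V) → N} (h : IsGradedLinear P φ) :
    IsGradedLinear P (leibD (gradedBr br) (gradedAct act) q φ) := by
  induction q with
  | zero =>
    refine isGradedLinear_of_contract (fun x => ?_) fun s => ?_
    · rw [contract_leibD_zero]
      exact h.lieDer x
    · simp only [contract_leibD_zero]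
      exact h.lieDer_left s
  | succ q ih =>
    refine isGradedLinear_of_contract (fun x => ?_) fun s => ?_
    · rw [contract_leibD_succ]
      intro y i s
      have h1 := h.lieDer (br := br) (act := act) x y i s
      have h2 := ih (h.contract x) y i s
      refine ⟨fun u v => ?_, fun c u => ?_⟩
      · simp only [Pi.sub_apply, h1.map_add, h2.map_add]
        abel
      · simp only [Pi.sub_apply, h1.map_smul, h2.map_smul, smul_sub]
    · have h1 := h.lieDer_left (br := br) (act := act) s
      have h2 := h.contract_left s
      refine ⟨fun u v => ?_, fun c u => ?_⟩
      · simp only [contract_leibD_succ, h1.map_add, h2.map_add, map_add]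
        abel
      · simp only [contract_leibD_succ, h1.map_smul, h2.map_smul, map_smul, smul_sub]

/-- The three double brackets have the same first component, the sum of the three parameters. The
Jacobi identity is therefore an identity of second components, and `φ` is additive in those. -/
theorem IsGradedLinear.isLeibniz
    (hbr : ∀ p r x y z, br p x (br r y z) = br (p + r) (br p x y) z + br r y (br p x z))
    {q : ℕ} {φ : (Fin q → P × V) → N} (h : IsGradedLinear P φ) :
    IsLeibniz (gradedBr br) φ := by
  intro y i x z w
  have e1 : gradedBr br x (gradedBr br z w) =
      (x.1 + z.1 + w.1, br (x.1 + z.1) (br x.1 x.2 z.2) w.2 + br z.1 z.2 (br x.1 x.2 w.2)) := by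
    simp only [gradedBr, ← hbr, add_assoc]
  have e2 : gradedBr br z (gradedBr br x w) =
      (x.1 + z.1 + w.1, br z.1 z.2 (br x.1 x.2 w.2)) := by
    simp only [gradedBr, add_left_comm z.1, add_assoc]
  rw [e1, e2]
  exact (h y i _).map_add _ _

end GradedLinear

/-! ### Extension of scalars for multilinear maps -/

section ExtendScalars

variable {F : Type*} [CommRing F] {P : Type*} [CommRing P] [Algebra F P]
variable {A : Type*} [AddCommGroup A] [Module F A]
variable {N : Type*} [AddCommGroup N] [Module F N] [Module P N] [IsScalarTower F P N]

/-- The elements `1 ⊗ a` span `P ⊗ A` over `P`; currying treats one argument at a time. -/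
theorem multilinearMap_ext_one_tmul {q : ℕ}
    {g g' : MultilinearMap P (fun _ : Fin q => P ⊗[F] A) N}
    (h : ∀ a : Fin q → A, g (fun i => 1 ⊗ₜ a i) = g' fun i => 1 ⊗ₜ a i) : g = g' := by
  induction q with
  | zero =>
    ext x
    have := h Fin.elim0
    convert this
  | succ q ih =>
    have key : g.curryLeft = g'.curryLeft := by
      refine LinearMap.ext fun x => ?_
      induction x with
      | zero => simp
      | add x y hx hy => rw [map_add, map_add, hx, hy]
      | tmul s b =>
        have e : s ⊗ₜ[F] b = s • ((1 : P) ⊗ₜ[F] b) := by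
          rw [TensorProduct.smul_tmul', smul_eq_mul, mul_one]
        rw [e, map_smul, map_smul]
        congr 1
        refine ih fun a => ?_
        have := h (Fin.cons b a)
        have e' : (fun i => (1 : P) ⊗ₜ[F] (Fin.cons b a : Fin (q + 1) → A) i) =
            Fin.cons (1 ⊗ₜ b) fun i => 1 ⊗ₜ a i := by
          funext i
          refine Fin.cases ?_ (fun j => ?_) i <;> simp
        rw [e'] at this
        exact this
    rw [← MultilinearMap.uncurry_curryLeft g, key, MultilinearMap.uncurry_curryLeft]

instance multilinearMap_isScalarTower_base {q : ℕ} :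
    IsScalarTower F P (MultilinearMap P (fun _ : Fin q => P ⊗[F] A) N) :=
  ⟨fun c p f => by
    ext a
    simp [smul_assoc]⟩

variable (F P A N) in
/-- The `P`-multilinear extension of an `F`-multilinear map with values in a `P`-module. -/
def extendMulti : (q : ℕ) → MultilinearMap F (fun _ : Fin q => A) N →ₗ[F]
    MultilinearMap P (fun _ : Fin q => P ⊗[F] A) N
  | 0 =>
    { toFun := fun m => MultilinearMap.constOfIsEmpty P _ (m 0)
      map_add' := fun _ _ => rfl
      map_smul' := fun _ _ => rfl }
  | q + 1 =>
    -- With the first argument fixed, the others are extended by recursion; the result is then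
    -- extended `P`-linearly in the first.
    { toFun := fun m => (LinearMap.liftBaseChange P (extendMulti q ∘ₗ m.curryLeft)).uncurryLeft
      map_add' := fun m m' => by
        refine multilinearMap_ext_one_tmul fun a => ?_
        have e : (m + m').curryLeft (a 0) = m.curryLeft (a 0) + m'.curryLeft (a 0) := rfl
        simp [e]
      map_smul' := fun c m => by
        refine multilinearMap_ext_one_tmul fun a => ?_
        have e : (c • m).curryLeft (a 0) = c • m.curryLeft (a 0) := rfl
        simp [e] }

theorem extendMulti_one_tmul {q : ℕ} (m : MultilinearMap F (fun _ : Fin q => A) N)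
    (a : Fin q → A) : extendMulti F P A N q m (fun i => 1 ⊗ₜ a i) = m a := by
  induction q with
  | zero =>
    change m 0 = m a
    congr 1
    exact Subsingleton.elim _ _
  | succ q ih =>
    simp only [extendMulti, LinearMap.coe_mk, AddHom.coe_mk, LinearMap.uncurryLeft_apply,
      LinearMap.liftBaseChange_tmul, one_smul, LinearMap.comp_apply]
    refine (ih (m.curryLeft (a 0)) (Fin.tail a)).trans ?_
    simp

end ExtendScalars

/-! ### Conformal cochains as graded multilinear functions -/

section CochainExt

variable {F : Type u} {A : Type v} {M : Type w} [Field F]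
variable [AddCommGroup A] [Module F A]
variable [AddCommGroup M] [Module F M]
variable {P : Type*} [CommRing P] [Algebra F P]

variable (P) in
/-- The values `f_{p₁, …, p_q}(x₁, …, x_q)` for `p i` in a commutative `F`-algebra `P`, extended
`P`-linearly to `x i ∈ P ⊗ A`. -/
def cochainExt {q : ℕ} (f : MultiMaps F A M q) : (Fin q → P × (P ⊗[F] A)) → P ⊗[F] M := fun y =>
  extendMulti F P A (P ⊗[F] M) q
    ((substVars M fun i => (y i).1).compMultilinearMap f) fun i => (y i).2

theorem isGradedLinear_cochainExt {q : ℕ} (f : MultiMaps F A M q) :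
    IsGradedLinear P (cochainExt P f) := by
  intro y i s
  have e1 : ∀ u, (fun j => (Function.update y i (s, u) j).1) =
      Function.update (fun j => (y j).1) i s := fun u => Function.comp_update Prod.fst y i (s, u)
  have e2 : ∀ u, (fun j => (Function.update y i (s, u) j).2) =
      Function.update (fun j => (y j).2) i u := fun u => Function.comp_update Prod.snd y i (s, u)
  simp only [cochainExt, e1, e2]
  exact ⟨fun u v => MultilinearMap.map_update_add _ _ _ _ _,
    fun c u => MultilinearMap.map_update_smul _ _ _ _ _⟩

theorem cochainExt_one_tmul {q : ℕ} (f : MultiMaps F A M q) (p : Fin q → P) (a : Fin q → A) :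
    cochainExt P f (fun i => (p i, 1 ⊗ₜ a i)) = substVars M p (f a) :=
  extendMulti_one_tmul _ _

/-- The parameters `p` are arbitrary but frozen, so this is extensionality of `P`-multilinear maps
for each choice of `p`. -/
theorem gradedLinear_ext {q : ℕ} {φ ψ : (Fin q → P × (P ⊗[F] A)) → P ⊗[F] M}
    (hφ : IsGradedLinear P φ) (hψ : IsGradedLinear P ψ)
    (h : ∀ (p : Fin q → P) (a : Fin q → A),
      φ (fun i => (p i, 1 ⊗ₜ a i)) = ψ fun i => (p i, 1 ⊗ₜ a i)) : φ = ψ := by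
  funext y
  have : hφ.toMultilinearMap (fun i => (y i).1) = hψ.toMultilinearMap fun i => (y i).1 :=
    multilinearMap_ext_one_tmul fun a => h (fun i => (y i).1) a
  exact congrArg (fun m => m fun i => (y i).2) this

theorem lamProd_triple_ext {X Y Z W : Type*} [AddCommGroup X] [Module F X] [AddCommGroup Y]
    [Module F Y] [AddCommGroup Z] [Module F Z] [AddCommGroup W] [Module F W]
    {T T' : P ⊗[F] X →ₗ[P] P ⊗[F] Y →ₗ[P] P ⊗[F] Z →ₗ[P] P ⊗[F] W}
    (h : ∀ x y z, T (1 ⊗ₜ x) (1 ⊗ₜ y) (1 ⊗ₜ z) = T' (1 ⊗ₜ x) (1 ⊗ₜ y) (1 ⊗ₜ z)) : T = T' := by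
  refine TensorProduct.AlgebraTensorModule.curry_injective (LinearMap.ext_ring ?_)
  refine LinearMap.ext fun x => ?_
  refine TensorProduct.AlgebraTensorModule.curry_injective (LinearMap.ext_ring ?_)
  refine LinearMap.ext fun y => ?_
  refine TensorProduct.AlgebraTensorModule.curry_injective (LinearMap.ext_ring ?_)
  exact LinearMap.ext fun z => h x y z

variable [Module F[X] A] [IsScalarTower F F[X] A]
variable [Module F[X] M] [IsScalarTower F F[X] M]

/-- In the bracket part of `d` the first argument is a bracket, a general element of `P ⊗ A`, which
`insertFirst` handles. This identifies that construction with the full multilinear extension. -/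
theorem cochainExt_cons {q : ℕ} (f : MultiMaps F A M (q + 1)) (s : P) (x : P ⊗[F] A)
    (p : Fin q → P) (a : Fin q → A) :
    cochainExt P f (Fin.cons (s, x) fun i => (p i, 1 ⊗ₜ a i)) =
      insertFirst f (Fin.cons s p : Fin (q + 1) → P) x a := by
  have h := (isGradedLinear_cochainExt (P := P) f).cons s fun i => (p i, 1 ⊗ₜ a i)
  induction x with
  | zero => rw [h.map_zero, map_zero]; rfl
  | add x y hx hy => rw [h.map_add, map_add, hx, hy]; rfl
  | tmul t b =>
    have e : t ⊗ₜ[F] b = t • ((1 : P) ⊗ₜ[F] b) := by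
      rw [TensorProduct.smul_tmul', smul_eq_mul, mul_one]
    rw [insertFirst_tmul, e, h.map_smul, ← cochainExt_one_tmul]
    congr 2
    funext i
    refine Fin.cases ?_ (fun j => ?_) i <;> simp

theorem isAlt_cochainExt {q : ℕ} {f : MultiMaps F A M q} (hf : f ∈ cochains F A M q) :
    IsAlt (cochainExt P f) := by
  intro σ y
  have : (extendMulti F P A (P ⊗[F] M) q
        ((substVars M fun i => (y (σ i)).1).compMultilinearMap f)).domDomCongr σ =
      ((Equiv.Perm.sign σ : ℤˣ) : ℤ) • extendMulti F P A (P ⊗[F] M) q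
        ((substVars M fun i => (y i).1).compMultilinearMap f) := by
    refine multilinearMap_ext_one_tmul fun a => ?_
    rw [MultilinearMap.domDomCongr_apply, smul_apply, extendMulti_one_tmul, extendMulti_one_tmul]
    exact cochain_perm hf (fun i => (y i).1) σ a
  exact congrArg (fun m => m fun i => (y i).2) this

variable [LieConformalAlgebra F A] [LCModule F A M]

/-- The axiom lives in `A[λ, μ]`. Applying the algebra map `λ ↦ p`, `μ ↦ r` gives the identity on
elements `1 ⊗ a`, and trilinearity over `P` does the rest. -/
theorem lamProd_bracket_jacobi (p r : P) (x y z : P ⊗[F] A) :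
    lamProd (LieConformalAlgebra.bracket (F := F) (A := A)) p x
        (lamProd LieConformalAlgebra.bracket r y z) =
      lamProd LieConformalAlgebra.bracket (p + r)
        (lamProd LieConformalAlgebra.bracket p x y) z +
      lamProd LieConformalAlgebra.bracket r y (lamProd LieConformalAlgebra.bracket p x z) := by
  let B : P → P ⊗[F] A →ₗ[P] P ⊗[F] A →ₗ[P] P ⊗[F] A :=
    lamProd (LieConformalAlgebra.bracket (F := F) (A := A))
  let T : P ⊗[F] A →ₗ[P] P ⊗[F] A →ₗ[P] P ⊗[F] A →ₗ[P] P ⊗[F] A :=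
    LinearMap.mk₂ P (fun x y => B p x ∘ₗ B r y)
      (by intros; ext; simp) (by intros; ext; simp) (by intros; ext; simp) (by intros; ext; simp)
  let T' : P ⊗[F] A →ₗ[P] P ⊗[F] A →ₗ[P] P ⊗[F] A →ₗ[P] P ⊗[F] A :=
    LinearMap.mk₂ P (fun x y => B (p + r) (B p x y) + B r y ∘ₗ B p x)
      (by intros; ext; simp; abel) (by intros; ext; simp) (by intros; ext; simp; abel)
      (by intros; ext; simp)
  have : T = T' := by
    refine lamProd_triple_ext fun a b c => ?_
    have := congrArg (LinearMap.rTensor A (MvPolynomial.aeval ![p, r] :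
      MvPolynomial (Fin 2) F →ₐ[F] P).toLinearMap) (LieConformalAlgebra.jacobi (F := F) a b c)
    simp only [map_add, rTensor_lamProd, LinearMap.rTensor_tmul, AlgHom.toLinearMap_apply,
      map_one, MvPolynomial.aeval_X] at this
    exact this
  exact congrArg (fun S => S x y z) this

theorem lamProd_act_jacobi (p r : P) (x y : P ⊗[F] A) (n : P ⊗[F] M) :
    lamProd (LCModule.act (F := F) (A := A) (M := M)) p x (lamProd LCModule.act r y n) -
      lamProd (LCModule.act (F := F) (A := A) (M := M)) r y (lamProd LCModule.act p x n) =
    lamProd LCModule.act (p + r)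
      (lamProd (LieConformalAlgebra.bracket (F := F) (A := A)) p x y) n := by
  let B : P → P ⊗[F] A →ₗ[P] P ⊗[F] A →ₗ[P] P ⊗[F] A :=
    lamProd (LieConformalAlgebra.bracket (F := F) (A := A))
  let C : P → P ⊗[F] A →ₗ[P] P ⊗[F] M →ₗ[P] P ⊗[F] M :=
    lamProd (LCModule.act (F := F) (A := A) (M := M))
  let T : P ⊗[F] A →ₗ[P] P ⊗[F] A →ₗ[P] P ⊗[F] M →ₗ[P] P ⊗[F] M :=
    LinearMap.mk₂ P (fun x y => C p x ∘ₗ C r y - C r y ∘ₗ C p x)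
      (by intros; ext; simp; abel) (by intros; ext; simp [smul_sub])
      (by intros; ext; simp; abel) (by intros; ext; simp [smul_sub])
  let T' : P ⊗[F] A →ₗ[P] P ⊗[F] A →ₗ[P] P ⊗[F] M →ₗ[P] P ⊗[F] M :=
    LinearMap.mk₂ P (fun x y => C (p + r) (B p x y))
      (by intros; ext; simp) (by intros; ext; simp) (by intros; ext; simp) (by intros; ext; simp)
  have : T = T' := by
    refine lamProd_triple_ext fun a b c => ?_
    have := congrArg (LinearMap.rTensor M (MvPolynomial.aeval ![p, r] :
      MvPolynomial (Fin 2) F →ₐ[F] P).toLinearMap) (LCModule.jacobi (F := F) a b c)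
    simp only [map_add, map_sub, rTensor_lamProd, LinearMap.rTensor_tmul,
      AlgHom.toLinearMap_apply, map_one, MvPolynomial.aeval_X] at this
    exact this
  exact congrArg (fun S => S x y n) this

variable (F A M P) in
/-- The Leibniz differential on graded functions attached to the `λ`-bracket and `λ`-action. -/
abbrev conformalLeibD (q : ℕ) :
    ((Fin q → P × (P ⊗[F] A)) → P ⊗[F] M) →ₗ[P] ((Fin (q + 1) → P × (P ⊗[F] A)) → P ⊗[F] M) :=
  leibD (gradedBr (lamProd (LieConformalAlgebra.bracket (F := F) (A := A))))
    (gradedAct (lamProd (LCModule.act (F := F) (A := A) (M := M)))) q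

theorem substVars_actionPart {q : ℕ} (f : MultiMaps F A M q) (p : Fin (q + 1) → P)
    (a : Fin (q + 1) → A) :
    substVars M p (actionPart f a) =
      ceAction (gradedAct (lamProd (LCModule.act (F := F) (A := A) (M := M)))) (cochainExt P f)
        fun i => (p i, 1 ⊗ₜ a i) := by
  rw [actionPart_apply, map_sum, ceAction]
  refine Finset.sum_congr rfl fun k _ => ?_
  rw [map_zsmul, cochainExt_one_tmul f (fun j => p (k.succAbove j)) fun j => a (k.succAbove j)]
  conv_lhs => rw [substVars, rTensor_lamProd]
  simp only [LinearMap.rTensor_tmul, AlgHom.toLinearMap_apply, map_one, MvPolynomial.aeval_X,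
    rTensor_substVars, gradedAct]

theorem substVars_bracketPart {q : ℕ} (f : MultiMaps F A M (q + 1)) (p : Fin (q + 2) → P)
    (a : Fin (q + 2) → A) :
    substVars M p (bracketPart f a) =
      ceBracket (gradedBr (lamProd (LieConformalAlgebra.bracket (F := F) (A := A))))
        (cochainExt P f) fun i => (p i, 1 ⊗ₜ a i) := by
  rw [bracketPart_apply, map_sum, ceBracket]
  refine Finset.sum_congr rfl fun l _ => ?_
  rw [map_sum]
  refine Finset.sum_congr rfl fun k _ => ?_
  split_ifs with h
  · rw [map_zsmul, gradedBr, cochainExt_cons f _ _ (fun j => p (l.succAbove (k.succAbove j)))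
      fun j => a (l.succAbove (k.succAbove j))]
    conv_lhs => rw [substVars, rTensor_insertFirst, rTensor_lamProd]
    simp only [LinearMap.rTensor_tmul, AlgHom.toLinearMap_apply, map_one, MvPolynomial.aeval_X]
    congr 3
    refine congrArg (insertFirst f) (funext fun i => ?_)
    refine Fin.cases ?_ (fun j => ?_) i <;> simp
  · exact map_zero _

/-- This is the bridge to the formal calculus. Both sides are graded linear, so it is enough to
compare them on arguments `(p i, 1 ⊗ a i)`, where the two sums defining `d` are literally the
Chevalley–Eilenberg sums. Skew-symmetry of `f` then allows the passage to the Leibniz differential.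
-/
theorem cochainExt_differential {q : ℕ} {f : MultiMaps F A M q} (hf : f ∈ cochains F A M q) :
    cochainExt P (differential F A M q f) = conformalLeibD F A M P q (cochainExt P f) := by
  refine gradedLinear_ext (isGradedLinear_cochainExt _)
    (isGradedLinear_cochainExt f).leibD fun p a => ?_
  rw [cochainExt_one_tmul]
  cases q with
  | zero =>
    rw [conformalLeibD, ← ceAction_zero]
    exact substVars_actionPart f p a
  | succ q =>
    rw [conformalLeibD, ← ceD_eq_leibD (isAlt_cochainExt hf), Pi.add_apply,
      ← substVars_actionPart, ← substVars_bracketPart, ← map_add]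
    rfl

theorem substVars_X {q : ℕ} (z : MvPolynomial (Fin q) F ⊗[F] M) :
    substVars M (fun i => (MvPolynomial.X i : MvPolynomial (Fin q) F)) z = z := by
  have : (MvPolynomial.aeval fun i => (MvPolynomial.X i : MvPolynomial (Fin q) F)) =
      AlgHom.id F _ := by
    ext i
    simp
  rw [substVars, this]
  exact LinearMap.rTensor_id_apply _ _ z

theorem cochainExt_X {q : ℕ} (f : MultiMaps F A M q) (a : Fin q → A) :
    cochainExt (MvPolynomial (Fin q) F) f (fun i => (MvPolynomial.X i, 1 ⊗ₜ a i)) = f a := by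
  rw [cochainExt_one_tmul, substVars_X]

theorem differential_differential [CharZero F] {q : ℕ} {f : MultiMaps F A M q}
    (hf : f ∈ cochains F A M q) :
    differential F A M (q + 1) (differential F A M q f) = 0 := by
  ext a : 1
  rw [← cochainExt_X, cochainExt_differential (differential_mem hf), cochainExt_differential hf,
    conformalLeibD, conformalLeibD, leibD_leibD]
  · rfl
  · exact fun x y n => lamProd_act_jacobi x.1 y.1 x.2 y.2 n
  · exact (isGradedLinear_cochainExt f).isLeibniz lamProd_bracket_jacobi

end CochainExt

/-! ### The operator `∂` is null-homotopic -/

section Homotopy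

variable {F : Type u} {A : Type v} {M : Type w} [Field F]
variable [AddCommGroup A] [Module F A] [Module F[X] A] [IsScalarTower F F[X] A]
variable [AddCommGroup M] [Module F M] [Module F[X] M] [IsScalarTower F F[X] M]
variable {P : Type*} [CommRing P] [Algebra F P]

theorem derivLast_lTensor {q : ℕ} (T : M →ₗ[F] M)
    (z : MvPolynomial (Fin (q + 1)) F ⊗[F] M) :
    derivLast F M q (LinearMap.lTensor _ T z) = LinearMap.lTensor _ T (derivLast F M q z) := by
  induction z with
  | zero => simp
  | tmul s y => simp [derivLast]
  | add y z hy hz => simp only [map_add, hy, hz]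

/-- By the product rule `(λz)' = z + λz'`, and the second term vanishes at `λ = 0`. -/
theorem derivLast_X_last_smul {q : ℕ} (z : MvPolynomial (Fin (q + 1)) F ⊗[F] M) :
    derivLast F M q ((MvPolynomial.X (Fin.last q) : MvPolynomial (Fin (q + 1)) F) • z) =
      substVars M (Fin.snoc (fun i => MvPolynomial.X i) 0 :
        Fin (q + 1) → MvPolynomial (Fin q) F) z := by
  induction z with
  | zero => simp
  | tmul s y =>
    simp [derivLast, substVars, TensorProduct.smul_tmul', Derivation.leibniz]
  | add y z hy hz => simp only [map_add, smul_add, hy, hz]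

theorem derivLast_delCochain {q : ℕ} (f : MultiMaps F A M (q + 1)) (a : Fin (q + 1) → A) :
    derivLast F M q (delCochain F A M (q + 1) f a) =
      LinearMap.lTensor _ (del F M) (derivLast F M q (f a)) +
        (∑ k : Fin q, (MvPolynomial.X k : MvPolynomial (Fin q) F)) • derivLast F M q (f a) +
      substVars M (Fin.snoc (fun i => MvPolynomial.X i) 0 :
        Fin (q + 1) → MvPolynomial (Fin q) F) (f a) := by
  rw [delCochain_apply, map_add, derivLast_lTensor, Fin.sum_univ_castSucc, add_smul,
    Finset.sum_smul, map_add, map_sum, derivLast_X_last_smul, Finset.sum_smul, add_assoc]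
  simp only [derivLast_smul]

/-- `τ` and `∂` fail to commute only because `∂` in degree `q + 1` also multiplies by the last
variable `λ`; differentiating that factor leaves `f` at `λ = 0`. Rotating `L` and its parameter `0`
from last to first place costs `(-1) ^ q`, which cancels the sign in `τ`. -/
theorem tauMulti_delCochain {q : ℕ} (L : A) {f : MultiMaps F A M (q + 1)}
    (hf : f ∈ cochains F A M (q + 1)) (a : Fin q → A) :
    tauMulti L q (delCochain F A M (q + 1) f) a =
      delCochain F A M q (tauMulti L q f) a +
        substVars M (Fin.cons 0 fun i => MvPolynomial.X i :
          Fin (q + 1) → MvPolynomial (Fin q) F) (f (Fin.cons L a)) := by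
  have h := cochain_perm hf (Fin.cons 0 fun i => MvPolynomial.X i :
    Fin (q + 1) → MvPolynomial (Fin q) F) (finRotate (q + 1)) (Fin.cons L a)
  have e : (Fin.cons L a : Fin (q + 1) → A) ∘ finRotate (q + 1) = Fin.snoc a L :=
    (Fin.snoc_eq_cons_rotate a L).symm
  rw [e, sign_finRotate, ← Fin.snoc_eq_cons_rotate
    (α := MvPolynomial (Fin q) F) (fun i => MvPolynomial.X i) 0] at h
  push_cast at h
  rw [tauMulti_apply, derivLast_delCochain, h, smul_add, smul_smul, ← mul_pow, delCochain_apply,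
    tauMulti_apply, map_zsmul, smul_add, smul_comm (∑ k : Fin q, _)]
  simp

theorem substLam_zero {W : Type*} [AddCommGroup W] [Module F W] (z : F[X] ⊗[F] W) :
    substLam W (0 : P) z =
      1 ⊗ₜ TensorProduct.lid F W (LinearMap.rTensor W (Polynomial.lcoeff F 0) z) := by
  induction z with
  | zero => simp
  | tmul s y =>
    simp [substLam, TensorProduct.tmul_smul, TensorProduct.smul_tmul',
      Polynomial.aeval_def, Polynomial.eval₂_at_zero, Algebra.algebraMap_eq_smul_one]
  | add y z hy hz => simp only [map_add, TensorProduct.tmul_add, hy, hz]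

theorem lamProd_zero {U V W : Type*} [AddCommGroup U] [Module F U] [AddCommGroup V] [Module F V]
    [AddCommGroup W] [Module F W] (B : U →ₗ[F] V →ₗ[F] F[X] ⊗[F] W) (x : U) (z : P ⊗[F] V) :
    lamProd B (0 : P) (1 ⊗ₜ x) z = LinearMap.lTensor P (jProd B 0 x) z := by
  induction z with
  | zero => simp
  | tmul s y =>
    rw [lamProd_tmul, substLam_zero, one_mul, TensorProduct.smul_tmul', smul_eq_mul, mul_one]
    simp [jProd]
  | add y z hy hz => simp only [map_add, hy, hz]

/-- The contraction `f ↦ f_{λ₁, …, λ_q, λ}(…, L)|_{λ = 0}`, up to sign; see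
`contractZero_apply`. -/
def contractZero (M : Type w) [AddCommGroup M] [Module F M] [Module F[X] M]
    [IsScalarTower F F[X] M] (L : A) (q : ℕ) :
    cochains F A M (q + 1) →ₗ[F] cochains F A M q :=
  tau M L q ∘ₗ delC F A M (q + 1) - delC F A M q ∘ₗ tau M L q

variable (L : A)

/-- Since the contraction is the commutator of `τ` and `∂`, which both preserve cochains, its values
are again cochains with no separate check. -/
theorem contractZero_apply {q : ℕ} (f : cochains F A M (q + 1)) (a : Fin q → A) :
    (contractZero M L q f : MultiMaps F A M q) a =
      substVars M (Fin.cons 0 fun i => MvPolynomial.X i :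
        Fin (q + 1) → MvPolynomial (Fin q) F) ((f : MultiMaps F A M (q + 1)) (Fin.cons L a)) := by
  have := tauMulti_delCochain L f.2 a
  change tauMulti L q (delCochain F A M (q + 1) f) a - delCochain F A M q (tauMulti L q f) a = _
  rw [this, add_sub_cancel_left]

variable [LieConformalAlgebra F A] [LCModule F A M]

theorem cochainExt_contractZero {q : ℕ} (f : cochains F A M (q + 1)) :
    cochainExt P (contractZero M L q f : MultiMaps F A M q) =
      contract P (0, 1 ⊗ₜ L) (cochainExt P (f : MultiMaps F A M (q + 1))) := by
  refine gradedLinear_ext (isGradedLinear_cochainExt _)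
    ((isGradedLinear_cochainExt _).contract _) fun p a => ?_
  rw [cochainExt_one_tmul, contractZero_apply, contract_apply, cochainExt_cons, insertFirst_tmul,
    one_smul]
  refine (rTensor_substVars (MvPolynomial.aeval p : MvPolynomial (Fin q) F →ₐ[F] P) _ _).trans ?_
  congr 2
  funext i
  refine Fin.cases ?_ (fun j => ?_) i <;> simp

/-- At parameter 0 the product with `L` is `L_(0)`, so the action gives `∂` on `M` and the bracket
replaces each `a i` by `∂ (a i)`. Conformal antilinearity turns the latter into multiplication by
`-λ_i`, and the sum enters the Lie derivative with a minus sign. -/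
theorem lieDer_cochainExt {q : ℕ} {f : MultiMaps F A M q} (hf : f ∈ cochains F A M q)
    (h0 : jProd (LieConformalAlgebra.bracket (F := F) (A := A)) 0 L = del F A)
    (h1 : jProd (LCModule.act (F := F) (A := A) (M := M)) 0 L = del F M)
    (a : Fin q → A) :
    lieDer (gradedBr (lamProd (LieConformalAlgebra.bracket (F := F) (A := A))))
        (gradedAct (lamProd (LCModule.act (F := F) (A := A) (M := M)))) (0, 1 ⊗ₜ L)
        (cochainExt (MvPolynomial (Fin q) F) f) (fun i => (MvPolynomial.X i, 1 ⊗ₜ a i)) =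
      delCochain F A M q f a := by
  -- The parameter of slot `i` stays `X i`, because bracketing with `(0, 1 ⊗ L)` adds 0 to it.
  have e : ∀ i, Function.update (fun j => ((MvPolynomial.X j : MvPolynomial (Fin q) F),
      (1 : MvPolynomial (Fin q) F) ⊗ₜ[F] a j)) i (MvPolynomial.X i, 1 ⊗ₜ del F A (a i)) =
      fun j => (MvPolynomial.X j, 1 ⊗ₜ (Function.update a i (del F A (a i)) j)) := by
    intro i
    funext j
    by_cases h : j = i
    · subst h; simp
    · simp [h]
  simp only [lieDer_apply, gradedBr, gradedAct, lamProd_zero, h0, h1, zero_add,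
    LinearMap.lTensor_tmul, e, cochainExt_X, hf.1]
  rw [delCochain_apply, Finset.sum_neg_distrib, sub_neg_eq_add, Finset.sum_smul]

variable [CharZero F]

theorem dC_dC {q : ℕ} (f : cochains F A M q) : dC F A M (q + 1) (dC F A M q f) = 0 :=
  Subtype.ext (differential_differential f.2)

theorem delC_eq {q : ℕ}
    (h0 : jProd (LieConformalAlgebra.bracket (F := F) (A := A)) 0 L = del F A)
    (h1 : jProd (LCModule.act (F := F) (A := A) (M := M)) 0 L = del F M)
    (f : cochains F A M (q + 1)) :
    delC F A M (q + 1) f = dC F A M q (contractZero M L q f) +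
      contractZero M L (q + 1) (dC F A M (q + 1) f) := by
  refine Subtype.ext (MultilinearMap.ext fun a => ?_)
  -- Cartan's formula for the direction `(0, 1 ⊗ L)`, evaluated at the generic parameters `λ_i`.
  have h := congrFun (contract_leibD_succ (R := MvPolynomial (Fin (q + 1)) F)
    (gradedBr (lamProd (LieConformalAlgebra.bracket (F := F) (A := A))))
    (gradedAct (lamProd (LCModule.act (F := F) (A := A) (M := M)))) (0, 1 ⊗ₜ L)
    (cochainExt (MvPolynomial (Fin (q + 1)) F) (f : MultiMaps F A M (q + 1))))
    (fun i => (MvPolynomial.X i, 1 ⊗ₜ a i))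
  have e := cochainExt_differential (P := MvPolynomial (Fin (q + 1)) F) f.2
  have e2 := cochainExt_differential (P := MvPolynomial (Fin (q + 1)) F) (contractZero M L q f).2
  have e3 := cochainExt_contractZero (P := MvPolynomial (Fin (q + 1)) F) L (dC F A M (q + 1) f)
  rw [conformalLeibD] at e e2
  rw [Pi.sub_apply, lieDer_cochainExt L f.2 h0 h1, ← cochainExt_contractZero, ← e2, ← e] at h
  have e4 := congrFun e3 (fun i => (MvPolynomial.X i, 1 ⊗ₜ a i))
  rw [cochainExt_X] at e4 h
  exact (eq_add_of_sub_eq' (h.symm.trans e4.symm)).trans rfl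

end Homotopy

/-! ### Injectivity of `∂` on cochains of positive degree -/

section Injective

variable {F : Type u} {A : Type v} {M : Type w} [Field F]
variable [AddCommGroup M] [Module F M]

/-- A leading-term argument in the variable `X 0`, which exists because there are `q + 1` variables:
multiplication by it raises the degree in `X 0`, whereas `T` and the other variables do not. -/
theorem lTensor_add_sum_X_smul_eq_zero {q : ℕ} (T : M →ₗ[F] M)
    {z : MvPolynomial (Fin (q + 1)) F ⊗[F] M}
    (h : LinearMap.lTensor (MvPolynomial (Fin (q + 1)) F) T z +
      (∑ k : Fin (q + 1), (MvPolynomial.X k : MvPolynomial (Fin (q + 1)) F)) • z = 0) :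
    z = 0 := by
  let Φ := TensorProduct.equivFinsuppOfBasisLeft (N := M)
    (MvPolynomial.basisMonomials (Fin (q + 1)) F)
  have hΦ : ∀ s y m, Φ (s ⊗ₜ y) m = MvPolynomial.coeff m s • y := fun s y m => by
    rw [TensorProduct.equivFinsuppOfBasisLeft_apply_tmul_apply]
    rfl
  have hT : ∀ (z : MvPolynomial (Fin (q + 1)) F ⊗[F] M) m,
      Φ (LinearMap.lTensor (MvPolynomial (Fin (q + 1)) F) T z) m = T (Φ z m) := by
    intro z m
    induction z with
    | zero => simp
    | tmul s y => simp [hΦ]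
    | add y z hy hz => simp only [map_add, Finsupp.add_apply, hy, hz]
  have hX : ∀ (z : MvPolynomial (Fin (q + 1)) F ⊗[F] M) (i : Fin (q + 1)) m,
      Φ ((MvPolynomial.X i : MvPolynomial (Fin (q + 1)) F) • z) m =
        if i ∈ m.support then Φ z (m - Finsupp.single i 1) else 0 := by
    intro z i m
    induction z with
    | zero => simp
    | tmul s y =>
      simp only [TensorProduct.smul_tmul', smul_eq_mul, hΦ, MvPolynomial.coeff_X_mul']
      split_ifs <;> simp
    | add y z hy hz =>
      simp only [map_add, smul_add, Finsupp.add_apply, hy, hz]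
      split_ifs <;> simp
  by_contra hz
  have hne : (Φ z).support.Nonempty := by
    rw [Finsupp.support_nonempty_iff]
    simpa using hz
  -- A monomial of `z` whose exponent of `X 0` is as large as possible.
  obtain ⟨n, hn, hmax⟩ := Finset.exists_max_image (Φ z).support (fun n => n 0) hne
  have hbig : ∀ m : Fin (q + 1) →₀ ℕ, m 0 = n 0 + 1 → Φ z m = 0 := by
    intro m hm
    by_contra hc
    have := hmax m (Finsupp.mem_support_iff.2 hc)
    omega
  -- In the coefficient at `n + e₀` only `X 0 • z` contributes, with the nonzero coefficient of `z`
  -- at `n`. The other terms involve coefficients of `z` at exponents with value `n 0 + 1` at `0`,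
  -- which vanish by maximality.
  have key := congrArg (fun w => Φ w (n + Finsupp.single 0 1)) h
  simp only [map_add, Finset.sum_smul, map_sum, Finsupp.add_apply, Finsupp.finsetSum_apply, hT,
    hX, map_zero, Finsupp.coe_zero, Pi.zero_apply] at key
  rw [hbig (n + Finsupp.single 0 1) (by simp), map_zero, zero_add,
    Finset.sum_eq_single (0 : Fin (q + 1))] at key
  · rw [if_pos (by simp), add_tsub_cancel_right] at key
    exact Finsupp.mem_support_iff.1 hn key
  · intro i _ hi
    split_ifs
    · exact hbig _ (by simp [hi])
    · rfl
  · simp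

variable [AddCommGroup A] [Module F A] [Module F[X] A] [IsScalarTower F F[X] A]
variable [Module F[X] M] [IsScalarTower F F[X] M] [CharZero F]

theorem delC_injective (q : ℕ) : Function.Injective (delC F A M (q + 1)) := by
  rw [injective_iff_map_eq_zero]
  intro f hf
  refine Subtype.ext (MultilinearMap.ext fun a => ?_)
  have h : delCochain F A M (q + 1) f a = 0 :=
    congrArg (fun g : cochains F A M (q + 1) => (g : MultiMaps F A M (q + 1)) a) hf
  rw [delCochain_apply] at h
  exact lTensor_add_sum_X_smul_eq_zero _ h

end Injective

/-! ### Reduced cohomology in terms of basic cohomology -/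

section Splitting

variable {F : Type u} {A : Type v} {M : Type w} [Field F] [CharZero F]
variable [AddCommGroup A] [Module F A] [Module F[X] A] [IsScalarTower F F[X] A]
variable [AddCommGroup M] [Module F M] [Module F[X] M] [IsScalarTower F F[X] M]
variable [LieConformalAlgebra F A] [LCModule F A M]

theorem proj_mem_reducedCocycles_iff {q : ℕ} (f : cochains F A M q) :
    proj f ∈ reducedCocycles F A M q ↔ ∃ g, dC F A M q f = delC F A M (q + 1) g := by
  change proj (dC F A M q f) = 0 ↔ _
  refine (Submodule.Quotient.mk_eq_zero _).trans ?_
  simp only [LinearMap.mem_range, eq_comm]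

theorem proj_mem_reducedCoboundaries_iff {q : ℕ} (f : cochains F A M (q + 1)) :
    proj f ∈ reducedCoboundaries F A M (q + 1) ↔
      ∃ h k, f = dC F A M q h + delC F A M (q + 1) k := by
  constructor
  · rintro ⟨y, hy⟩
    obtain ⟨h, rfl⟩ := Submodule.Quotient.mk_surjective _ y
    obtain ⟨k, hk⟩ := (Submodule.Quotient.eq _).1 (hy.symm : proj f = proj (dC F A M q h))
    exact ⟨h, k, by rw [hk]; abel⟩
  · rintro ⟨h, k, rfl⟩
    refine ⟨proj h, ?_⟩
    exact ((Submodule.Quotient.eq (LinearMap.range (delC F A M (q + 1)))).2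
      ⟨k, by abel⟩ : proj (dC F A M q h + delC F A M (q + 1) k) = proj (dC F A M q h)).symm

variable (F A M) in
/-- A basic cocycle, viewed as a cocycle of the reduced complex. -/
def projCocycle (q : ℕ) : basicCocycles F A M q →ₗ[F] reducedCocycles F A M q :=
  LinearMap.codRestrict _ (Submodule.mkQ _ ∘ₗ Submodule.subtype _) fun f =>
    (proj_mem_reducedCocycles_iff (f : cochains F A M q)).2
      ⟨0, by rw [map_zero]; exact f.2⟩

theorem dC_contractZero {L : A}
    (h0 : jProd (LieConformalAlgebra.bracket (F := F) (A := A)) 0 L = del F A)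
    (h1 : jProd (LCModule.act (F := F) (A := A) (M := M)) 0 L = del F M)
    {q : ℕ} {g : cochains F A M (q + 1)} (hg : g ∈ basicCocycles F A M (q + 1)) :
    dC F A M q (contractZero M L q g) = delC F A M (q + 1) g := by
  have : dC F A M (q + 1) g = 0 := hg
  rw [delC_eq L h0 h1, this, map_zero, add_zero]

variable {L : A}
  (h0 : jProd (LieConformalAlgebra.bracket (F := F) (A := A)) 0 L = del F A)
  (h1 : jProd (LCModule.act (F := F) (A := A) (M := M)) 0 L = del F M)

/-- The contraction of a basic cocycle with `L`, viewed as a cocycle of the reduced complex. -/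
def contractCocycle (q : ℕ) : basicCocycles F A M (q + 1) →ₗ[F] reducedCocycles F A M q :=
  LinearMap.codRestrict _
    (Submodule.mkQ _ ∘ₗ contractZero M L q ∘ₗ Submodule.subtype _) fun g =>
    (proj_mem_reducedCocycles_iff (contractZero M L q (g : cochains F A M (q + 1)))).2
      ⟨g, dC_contractZero h0 h1 g.2⟩

variable (F A M) in
/-- The map `H̃^q → H^q` induced by the projection, for `q ≥ 1`. -/
def projClass (q : ℕ) :
    BasicCohomology F A M (q + 1) →ₗ[F] ReducedCohomology F A M (q + 1) :=
  Submodule.mapQ _ _ (projCocycle F A M (q + 1)) (by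
    rintro f ⟨h, hh⟩
    exact (proj_mem_reducedCoboundaries_iff (f : cochains F A M (q + 1))).2
      ⟨h, 0, by rw [map_zero, add_zero]; exact hh.symm⟩)

/-- The map `H̃^{q+1} → H^q` induced by the contraction with `L`, for `q ≥ 1`. -/
def contractClass (q : ℕ) :
    BasicCohomology F A M (q + 2) →ₗ[F] ReducedCohomology F A M (q + 1) :=
  Submodule.mapQ _ _ (contractCocycle h0 h1 (q + 1)) (by
    rintro g ⟨h, hh⟩
    refine (proj_mem_reducedCoboundaries_iff
      (contractZero M L (q + 1) (g : cochains F A M (q + 2)))).2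
      -- The homotopy formula in the form `ι(dh) = d(-ιh) + ∂h`.
      ⟨-contractZero M L q h, h, ?_⟩
    have hh' : dC F A M (q + 1) h = g := hh
    rw [delC_eq L h0 h1, hh', map_neg, neg_add_cancel_left])

/-- The map `H̃^q × H̃^{q+1} → H^q` induced by the projection and by the contraction with `L`, for
`q ≥ 1`. -/
def splitting (q : ℕ) :
    BasicCohomology F A M (q + 1) × BasicCohomology F A M (q + 2) →ₗ[F]
      ReducedCohomology F A M (q + 1) :=
  LinearMap.coprod (projClass F A M q) (contractClass h0 h1 q)

theorem splitting_inl (q : ℕ) (x : BasicCohomology F A M (q + 1)) :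
    splitting h0 h1 q (x, 0) = projClass F A M q x :=
  (LinearMap.coprod_apply _ _ _).trans
    ((congrArg (projClass F A M q x + ·) (contractClass h0 h1 q).map_zero).trans (add_zero _))

theorem splitting_inr (q : ℕ) (y : BasicCohomology F A M (q + 2)) :
    splitting h0 h1 q (0, y) = contractClass h0 h1 q y :=
  (LinearMap.coprod_apply _ _ _).trans
    ((congrArg (· + contractClass h0 h1 q y) (projClass F A M q).map_zero).trans (zero_add _))

/-- From `f + ιg = dh + ∂k`, applying `d` shows that `g` is the coboundary of `k`; the homotopy
formula for `k` then cancels `ιg`. -/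
theorem splitting_injective (q : ℕ) : Function.Injective (splitting h0 h1 q) := by
  rw [injective_iff_map_eq_zero]
  rintro ⟨x, y⟩ hxy
  obtain ⟨f, rfl⟩ := Submodule.Quotient.mk_surjective _ x
  obtain ⟨g, rfl⟩ := Submodule.Quotient.mk_surjective _ y
  have hf : dC F A M (q + 1) (f : cochains F A M (q + 1)) = 0 := f.2
  have hm : proj ((f : cochains F A M (q + 1)) +
      contractZero M L (q + 1) (g : cochains F A M (q + 2))) ∈
      reducedCoboundaries F A M (q + 1) := by
    have e : splitting h0 h1 q (Submodule.Quotient.mk f, Submodule.Quotient.mk g) =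
        Submodule.Quotient.mk
          (projCocycle F A M (q + 1) f + contractCocycle h0 h1 (q + 1) g) := rfl
    rw [e, Submodule.Quotient.mk_eq_zero] at hxy
    exact hxy
  obtain ⟨h, k, hk⟩ := (proj_mem_reducedCoboundaries_iff _).1 hm
  -- After `d` the equation reads `∂g = ∂(dk)`, and `∂` can be cancelled.
  have hg : (g : cochains F A M (q + 2)) = dC F A M (q + 1) k := by
    refine delC_injective (q + 1) ?_
    have := congrArg (dC F A M (q + 1)) hk
    rwa [map_add, map_add, hf, dC_contractZero h0 h1 g.2, dC_dC, dC_delC, zero_add,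
      zero_add] at this
  have hf' : (f : cochains F A M (q + 1)) = dC F A M q (h + contractZero M L q k) := by
    rw [map_add]
    rw [delC_eq L h0 h1 k, ← hg, ← add_assoc] at hk
    exact add_right_cancel hk
  refine Prod.ext ?_ ?_
  · exact (Submodule.Quotient.mk_eq_zero _).2 ⟨_, hf'.symm⟩
  · exact (Submodule.Quotient.mk_eq_zero _).2 ⟨_, hg.symm⟩

/-- A reduced cocycle lifts to `f` with `df = ∂g`. Here `g` is a basic cocycle because `∂` is
injective, and subtracting `ιg`, which has the same differential `∂g`, makes `f` a basic cocycle. -/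
theorem splitting_surjective (q : ℕ) : Function.Surjective (splitting h0 h1 q) := by
  intro x
  obtain ⟨⟨y, hy⟩, rfl⟩ := Submodule.Quotient.mk_surjective _ x
  obtain ⟨f, rfl⟩ := Submodule.Quotient.mk_surjective _ y
  obtain ⟨g, hg⟩ := (proj_mem_reducedCocycles_iff f).1 hy
  have hg' : g ∈ basicCocycles F A M (q + 2) := by
    refine LinearMap.mem_ker.2 (delC_injective (q + 2) ?_)
    rw [← dC_delC, ← hg, dC_dC, map_zero]
  have hf' : f - contractZero M L (q + 1) g ∈ basicCocycles F A M (q + 1) := by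
    rw [basicCocycles, LinearMap.mem_ker, map_sub, dC_contractZero h0 h1 hg', hg, sub_self]
  refine ⟨(Submodule.Quotient.mk ⟨_, hf'⟩, Submodule.Quotient.mk ⟨g, hg'⟩), ?_⟩
  refine congrArg (Submodule.Quotient.mk
    (p := (reducedCoboundaries F A M (q + 1)).submoduleOf (reducedCocycles F A M (q + 1))))
    (Subtype.ext ?_ : projCocycle F A M (q + 1) ⟨_, hf'⟩ +
      contractCocycle h0 h1 (q + 1) ⟨g, hg'⟩ = ⟨_, hy⟩)
  exact congrArg proj (sub_add_cancel f (contractZero M L (q + 1) g))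

/-- The isomorphism `H̃^q × H̃^{q+1} ≃ H^q` for `q ≥ 1`. -/
def splittingEquiv (q : ℕ) :
    (BasicCohomology F A M (q + 1) × BasicCohomology F A M (q + 2)) ≃ₗ[F]
      ReducedCohomology F A M (q + 1) :=
  LinearEquiv.ofBijective (splitting h0 h1 q)
    ⟨splitting_injective h0 h1 q, splitting_surjective h0 h1 q⟩

/-- The two representatives differ by `∂(τg)`. -/
theorem proj_tau_delC {q : ℕ} (g : cochains F A M (q + 1)) :
    proj (tau M L q (delC F A M (q + 1) g)) = proj (contractZero M L q g) :=
  (Submodule.Quotient.eq _).2 ⟨tau M L q g, by simp [contractZero]⟩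

theorem isReducedClass_splitting_inl {q : ℕ} (f : basicCocycles F A M (q + 1)) :
    IsReducedClass (splitting h0 h1 q (basicClass f, 0)) (f : cochains F A M (q + 1)) :=
  ⟨(projCocycle F A M (q + 1) f).2, splitting_inl h0 h1 q _⟩

theorem isReducedClass_splitting_inr {q : ℕ} (g : basicCocycles F A M (q + 2)) :
    IsReducedClass (splitting h0 h1 q (0, basicClass g))
      (tau M L (q + 1) (delC F A M (q + 2) (g : cochains F A M (q + 2)))) := by
  have e := proj_tau_delC (L := L) (g : cochains F A M (q + 2))
  have h : proj (tau M L (q + 1) (delC F A M (q + 2) (g : cochains F A M (q + 2)))) ∈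
      reducedCocycles F A M (q + 1) := e ▸ (contractCocycle h0 h1 (q + 1) g).2
  have e' : contractCocycle h0 h1 (q + 1) g = ⟨_, h⟩ := Subtype.ext e.symm
  exact ⟨h, (splitting_inr h0 h1 q _).trans (congrArg Submodule.Quotient.mk e')⟩

end Splitting

end LieConformal
end

/-! ### The dimension formula and the explicit basis -/

open LieConformal
theorem mainTheorem2 {F : Type*} {A : Type*} {M : Type*} [Field F] [CharZero F]
    [AddCommGroup A] [Module F A] [Module F[X] A] [IsScalarTower F F[X] A] [Module.Free F[X] A]
    [LieConformalAlgebra F A]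
    [AddCommGroup M] [Module F M] [Module F[X] M] [IsScalarTower F F[X] M] [Module.Free F[X] M]
    [LCModule F A M]
    (L : A) (hL : IsVirasoroElement F L) (hM : IsConformalModule F L M) (q : ℕ) (hq : 1 ≤ q) :
    Module.rank F (ReducedCohomology F A M q) =
        Module.rank F (BasicCohomology F A M q) + Module.rank F (BasicCohomology F A M (q + 1)) ∧
      ∀ (ι : Type*) (κ : Type*) (b : Module.Basis ι F (BasicCohomology F A M q))
        (c : Module.Basis κ F (BasicCohomology F A M (q + 1)))
        (f : ι → basicCocycles F A M q) (g : κ → basicCocycles F A M (q + 1)),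
        (∀ i, b i = basicClass (f i)) → (∀ j, c j = basicClass (g j)) →
        ∃ B : Module.Basis (ι ⊕ κ) F (ReducedCohomology F A M q),
          (∀ i, IsReducedClass (B (Sum.inl i)) (f i : cochains F A M q)) ∧
          (∀ j, IsReducedClass (B (Sum.inr j))
            (tau M L q (delC F A M (q + 1) (g j : cochains F A M (q + 1))))) := by
  -- The splitting is indexed by `p = q - 1`, so that coboundaries in degree `q` are the range of a
  -- differential.
  obtain ⟨q, rfl⟩ : ∃ p, q = p + 1 := ⟨q - 1, by omega⟩
  refine ⟨?_, fun ι κ b c f g hf hg => ?_⟩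
  · rw [← (splittingEquiv hL.zero_prod hM.zero_prod q).rank_eq, rank_prod']
  · refine ⟨(b.prod c).map (splittingEquiv hL.zero_prod hM.zero_prod q), fun i => ?_, fun j => ?_⟩
    · rw [Module.Basis.map_apply, Module.Basis.prod_apply]
      simp only [Sum.elim_inl, Function.comp_apply, LinearMap.inl_apply, hf]
      exact isReducedClass_splitting_inl _ _ _
    · rw [Module.Basis.map_apply, Module.Basis.prod_apply]
      simp only [Sum.elim_inr, Function.comp_apply, LinearMap.inr_apply, hg]
      exact isReducedClass_splitting_inr _ _ _
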